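/- All multigraphs are finite, connected, nonempty, may have loops and multiple edges, and have no vertex of degree one (a loop counts twice in the degree). For a multigraph $X$ let $r_X=|E_X|-|V_X|+1$ and let $\kappa_X$ be its number of spanning trees. Let ${\rm Div}(X)$ be the free abelian group on $V_X$, ${\rm Div}^{\circ}(X)$ its subgroup of divisors of degree $0$, ${\rm Pr}(X)$ the image of the Laplacian (degree matrix minus adjacency matrix), and ${\rm Jac}(X)={\rm Div}^{\circ}(X)/{\rm Pr}(X)$. Let $\pi:Y\to X$ be a Galois covering of multigraphs of degree $d$ whose automorphism group $G={\rm Aut}(Y/X)$ is abelian. A prime $\mathfrak p$ of $X$ is a class, up to the choice of the starting vertex, of closed paths (sequences of oriented edges) without backtrack or tail that are not proper powers of closed paths; $\nu(\mathfrak p)$ is its length. Its Frobenius $\left(\frac{Y/X}{\mathfrak p}\right)\in G$ is the automorphism $g$ with $g\cdot w=w'$, where $w'$ is the end point of the lift to $Y$, starting at a vertex $w$, of a path representing $\mathfrak p$. For a character $\chi\in\widehat G$, the Artin–Ihara $L$-function is the formal product $$L_{Y/X}(u,\chi)=\prod_{\mathfrak p}\left(1-\chi\left(\left(\tfrac{Y/X}{\mathfrak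 p}\right)\right)u^{\nu(\mathfrak p)}\right)^{-1}\in\mathbb C[[u]].$$ It is well defined (the product converges coefficientwise) and $L_{Y/X}(u,\chi)^{-1}$ is a polynomial in $u$. Let $L^*_{Y/X}(1,\chi)$ be the first non-vanishing Taylor coefficient of $L_{Y/X}(u,\chi)^{-1}$ at $u=1$, let $e_\chi=\frac1{|G|}\sum_{\sigma\in G}\chi(\sigma)\sigma^{-1}\in\mathbb C[G]$, and put $$\theta^*_{Y/X}(1)=\sum_{\chi\in\widehat G}L^*_{Y/X}(1,\chi)\,e_{\overline\chi},\qquad e=1-e_{\chi_1},$$ where $\chi_1$ is the trivial character. Let $N_G=\sum_{\sigma\in G}\sigma$ and ${\rm Jac}^0(Y)=\{[D]\in{\rm Jac}(Y)\mid N_G\cdot[D]=0\}$, and let $I_G$ be the augmentation ideal of $\mathbb Z[G]$. **Theorem.** One has $$|{\rm Jac}^0(Y)|=\frac{\kappa_Y}{\kappa_X}.$$ Moreover, $\theta^*_{Y/X}(1)\cdot e$ lies in $\mathbb Z[G]$, and in fact in $I_G$, and $$\bigl|I_G/\theta^*_{Y/X}(1)\cdot e\cdot\mathbb Z[G]\bigr|=2^{(d-1)(r_X-1)}\cdot|{\rm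 Jac}^0(Y)|.$$ -/

import Mathlib

open scoped PowerSeries.WithPiTopology

/-- A multigraph with vertex set `V` and edge set `E`; loops and multiple edges are allowed.
The edge `e` has the unordered pair `s(src e, tgt e)` as its set of end points.  The choice of which
end point is called `src` only serves to name the two orientations of an edge (which is needed for
loops); nothing below depends on it. -/
structure Multigraph (V E : Type*) where
  src : E → V
  tgt : E → V

namespace Multigraph

variable {V E W F : Type*}

/-- The unordered pair of end points of an edge. -/
def ends (X : Multigraph V E) (e : E) : Sym2 V := s(X.src e, X.tgt e)

/-! ### Oriented edges, walks, connectedness, spanning trees -/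

/-- Oriented edges: each edge `e` has exactly two orientations `(e, true)`, `(e, false)`. -/
abbrev Dart (_X : Multigraph V E) : Type _ := E × Bool

/-- The initial vertex of an oriented edge. -/
def init (X : Multigraph V E) (a : X.Dart) : V := if a.2 then X.src a.1 else X.tgt a.1

/-- The terminal vertex of an oriented edge. -/
def term (X : Multigraph V E) (a : X.Dart) : V := if a.2 then X.tgt a.1 else X.src a.1

/-- The same edge with the opposite orientation. -/
def inv (X : Multigraph V E) (a : X.Dart) : X.Dart := (a.1, !a.2)

/-- `X.IsWalk v l w`: the oriented edges in `l` can be traversed one after the other, starting at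
`v` and ending at `w` (the empty list goes from a vertex to itself). -/
def IsWalk (X : Multigraph V E) : V → List X.Dart → V → Prop
  | v, [], w => v = w
  | v, a :: l, w => X.init a = v ∧ X.IsWalk (X.term a) l w

/-- A closed path: a nonempty walk whose initial and terminal vertices agree. -/
def IsClosedPath (X : Multigraph V E) (l : List X.Dart) : Prop :=
  l ≠ [] ∧ ∃ v, X.IsWalk v l v

/-- A cycle: a closed path in which no edge is repeated (in either orientation) and in which the
terminal vertices of the oriented edges are distinct. -/
def IsCycle (X : Multigraph V E) (l : List X.Dart) : Prop :=
  X.IsClosedPath l ∧ (l.map Prod.fst).Nodup ∧ (l.map X.term).Nodup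

/-- The subgraph with all the vertices of `X`, and with edge set `T`, is connected. -/
def ConnectedBy (X : Multigraph V E) (T : Set E) : Prop :=
  Nonempty V ∧ ∀ v w : V, ∃ l : List X.Dart, (∀ a ∈ l, a.1 ∈ T) ∧ X.IsWalk v l w

/-- The multigraph is connected (and nonempty). -/
def Connected (X : Multigraph V E) : Prop := X.ConnectedBy Set.univ

/-- `T` is the edge set of a spanning tree: a connected subgraph containing all the vertices and no
cycles. -/
def IsSpanningTree (X : Multigraph V E) (T : Set E) : Prop :=
  X.ConnectedBy T ∧ ¬ ∃ l : List X.Dart, X.IsCycle l ∧ ∀ a ∈ l, a.1 ∈ T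

/-- The number `κ_X` of spanning trees. -/
noncomputable def kappa (X : Multigraph V E) : ℕ := Nat.card {T : Set E // X.IsSpanningTree T}

/-- `r_X = |E_X| - |V_X| + 1`. -/
noncomputable def betti (_X : Multigraph V E) : ℤ := (Nat.card E : ℤ) - Nat.card V + 1

/-- The valency of a vertex: the number of oriented edges that start there, so that a loop is
counted twice. -/
noncomputable def degree (X : Multigraph V E) (v : V) : ℕ := Nat.card {a : X.Dart // X.init a = v}

/-- The number of loops at a vertex. -/
noncomputable def loops (X : Multigraph V E) (v : V) : ℕ := Nat.card {e : E // X.ends e = s(v, v)}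

/-- The number of edges between two (distinct) vertices. -/
noncomputable def edgesBetween (X : Multigraph V E) (v w : V) : ℕ :=
  Nat.card {e : E // X.ends e = s(v, w)}

/-! ### Divisors and the Jacobian -/

open Classical in
/-- The entries `ρ_v(v₀)` of the Laplacian. -/
noncomputable def rho (X : Multigraph V E) (v v₀ : V) : ℤ :=
  if v = v₀ then (X.degree v₀ : ℤ) - 2 * X.loops v₀ else -(X.edgesBetween v v₀ : ℤ)

/-- The divisor group, the free abelian group on the vertices. -/
abbrev Div (_X : Multigraph V E) : Type _ := V →₀ ℤ

/-- The degree map `∑ n_v v ↦ ∑ n_v`. -/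
noncomputable def deg (X : Multigraph V E) : X.Div →ₗ[ℤ] ℤ :=
  Finsupp.lsum ℤ fun _ => LinearMap.id

/-- Divisors of degree zero. -/
noncomputable def DivZero (X : Multigraph V E) : Submodule ℤ X.Div := LinearMap.ker X.deg

/-- The map `div`, sending the characteristic function of `v₀` to `∑_v ρ_v(v₀) v`. -/
noncomputable def divMap [Fintype V] (X : Multigraph V E) : (V → ℤ) →ₗ[ℤ] X.Div :=
  ∑ v₀ : V, (LinearMap.proj v₀).smulRight (∑ v : V, Finsupp.single v (X.rho v v₀))

/-- Principal divisors. -/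
noncomputable def Pr [Fintype V] (X : Multigraph V E) : Submodule ℤ X.Div :=
  LinearMap.range X.divMap

/-- The Jacobian `Jac(X) = Div⁰(X) / Pr(X)`. -/
abbrev Jac [Fintype V] (X : Multigraph V E) : Type _ := X.DivZero ⧸ X.Pr.submoduleOf X.DivZero

/-! ### Primes -/

/-- A prime path: a closed path without backtrack and without tail, which is not a proper power of
a closed path. -/
def IsPrimePath (X : Multigraph V E) (l : List X.Dart) : Prop :=
  X.IsClosedPath l ∧ l.IsChain (fun a b => b ≠ X.inv a) ∧
    (∀ a ∈ l.head?, ∀ b ∈ l.getLast?, a ≠ X.inv b) ∧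
    ¬ ∃ (c : List X.Dart) (k : ℕ), X.IsClosedPath c ∧ 2 ≤ k ∧ l = (List.replicate k c).flatten

/-- The primes of `X`: prime paths up to cyclic rotation, that is, up to the choice of the
starting vertex. -/
def Prime (X : Multigraph V E) : Type _ :=
  {c : Cycle X.Dart // ∃ l : List X.Dart, (l : Cycle X.Dart) = c ∧ X.IsPrimePath l}

/-- The length `ν(𝔭)` of a prime. -/
def Prime.length {X : Multigraph V E} (p : X.Prime) : ℕ := Cycle.length p.1

/-! ### Covers -/

/-- A covering map `Y → X` of multigraphs: a map on vertices and on oriented edges, compatible with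
reversal of orientation and with initial (hence also terminal) vertices, which is a local
isomorphism: the oriented edges starting at a vertex `w` of `Y` are mapped bijectively onto those
starting at its image.  These are the (cellular) covering maps of the underlying one-dimensional
CW complexes, and `Deck` below is their group of covering transformations. -/
structure Cover (Y : Multigraph W F) (X : Multigraph V E) where
  vert : W → V
  dart : Y.Dart → X.Dart
  dart_inv : ∀ a, dart (Y.inv a) = X.inv (dart a)
  init_dart : ∀ a, X.init (dart a) = vert (Y.init a)
  bijOn_star : ∀ w, Set.BijOn dart {a | Y.init a = w} {b | X.init b = vert w}

namespace Cover

variable {Y : Multigraph W F} {X : Multigraph V E}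

/-- The automorphism group `Aut(Y/X)` of a cover: pairs consisting of a permutation of the vertices
and one of the oriented edges of `Y`, which form an automorphism of `Y` and lie over the identity
of `X`. -/
def Deck (π : Cover Y X) : Subgroup (Equiv.Perm W × Equiv.Perm Y.Dart) where
  carrier := {g | (∀ a, Y.init (g.2 a) = g.1 (Y.init a)) ∧ (∀ a, g.2 (Y.inv a) = Y.inv (g.2 a)) ∧
    (∀ w, π.vert (g.1 w) = π.vert w) ∧ ∀ a, π.dart (g.2 a) = π.dart a}
  one_mem' := by simp
  mul_mem' := by
    rintro g h ⟨g1, g2, g3, g4⟩ ⟨h1, h2, h3, h4⟩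
    simp [g1, g2, g3, g4, h1, h2, h3, h4]
  inv_mem' := by
    rintro g ⟨g1, g2, g3, g4⟩
    have k1 : ∀ w, g.1 (g.1⁻¹ w) = w := fun w => g.1.apply_symm_apply w
    have k2 : ∀ a, g.2 (g.2⁻¹ a) = a := fun a => g.2.apply_symm_apply a
    refine ⟨fun a => ?_, fun a => ?_, fun w => ?_, fun a => ?_⟩
    · exact g.1.injective (by rw [Prod.snd_inv, Prod.fst_inv, k1, ← g1, k2])
    · exact g.2.injective (by rw [Prod.snd_inv, g2, k2, k2])
    · rw [Prod.fst_inv, ← g3, k1]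
    · rw [Prod.snd_inv, ← g4, k2]

/-- The cover (with `Y` connected) is Galois: `Aut(Y/X)` acts transitively on the fibers. -/
def IsGalois (π : Cover Y X) : Prop :=
  ∀ w w' : W, π.vert w = π.vert w' → ∃ g : π.Deck, g.1.1 w = w'

noncomputable instance [Finite W] [Finite F] (π : Cover Y X) : Fintype π.Deck :=
  Fintype.ofFinite _

/-! ### The action of `Aut(Y/X)` on the Jacobian of `Y` -/

/-- The action of an automorphism on divisors, `∑ n_w w ↦ ∑ n_w g(w)`. -/
noncomputable def actDiv (π : Cover Y X) (g : π.Deck) : Y.Div →ₗ[ℤ] Y.Div :=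
  Finsupp.lmapDomain ℤ ℤ g.1.1

theorem deck_degree (π : Cover Y X) (g : π.Deck) (w : W) :
    Y.degree (g.1.1 w) = Y.degree w := by
  refine (Nat.card_congr (g.1.2.subtypeEquiv fun a => ?_)).symm
  rw [g.2.1 a, g.1.1.injective.eq_iff]

theorem ends_eq (a : Y.Dart) : Y.ends a.1 = s(Y.init a, Y.init (Y.inv a)) := by
  rcases a with ⟨e, _ | _⟩ <;> simp [ends, init, inv, Sym2.eq_swap]

theorem deck_ends (π : Cover Y X) (g : π.Deck) (a : Y.Dart) :
    Y.ends (g.1.2 a).1 = (Y.ends a.1).map g.1.1 := by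
  rw [ends_eq, ends_eq, Sym2.map_mk, ← g.2.2.1, g.2.1, g.2.1]

theorem deck_fst (π : Cover Y X) (g : π.Deck) (a b : Y.Dart) (h : a.1 = b.1) :
    (g.1.2 a).1 = (g.1.2 b).1 := by
  by_cases hab : a = b
  · rw [hab]
  · have : b = Y.inv a := by
      rcases a with ⟨e, _ | _⟩ <;> rcases b with ⟨f, _ | _⟩ <;> simp_all [inv]
    rw [this, g.2.2.1]
    rfl

/-- The permutation of the edges of `Y` induced by an automorphism of the cover. -/
def deckEdge (π : Cover Y X) (g : π.Deck) : Equiv.Perm F where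
  toFun e := (g.1.2 (e, true)).1
  invFun e := (g⁻¹.1.2 (e, true)).1
  left_inv e := by
    exact (π.deck_fst g⁻¹ ((g.1.2 (e, true)).1, true) (g.1.2 (e, true)) rfl).trans
      (congrArg Prod.fst (g.1.2.symm_apply_apply (e, true)))
  right_inv e := by
    exact (π.deck_fst g ((g⁻¹.1.2 (e, true)).1, true) (g⁻¹.1.2 (e, true)) rfl).trans
      (congrArg Prod.fst (g.1.2.apply_symm_apply (e, true)))

theorem deck_edgesBetween (π : Cover Y X) (g : π.Deck) (w w' : W) :
    Y.edgesBetween (g.1.1 w) (g.1.1 w') = Y.edgesBetween w w' := by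
  refine (Nat.card_congr ((π.deckEdge g).subtypeEquiv fun e => ?_)).symm
  have h : Y.ends (π.deckEdge g e) = (Y.ends e).map g.1.1 := π.deck_ends g (e, true)
  rw [h, ← Sym2.map_mk, (Sym2.map.injective g.1.1.injective).eq_iff]

theorem deck_rho (π : Cover Y X) (g : π.Deck) (w w' : W) :
    Y.rho (g.1.1 w) (g.1.1 w') = Y.rho w w' := by
  have h : Y.loops (g.1.1 w') = Y.loops w' := π.deck_edgesBetween g w' w'
  by_cases hw : w = w'
  · simp [rho, hw, deck_degree, h]
  · simp [rho, hw, deck_edgesBetween]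

theorem actDiv_divMap [Fintype W] (π : Cover Y X) (g : π.Deck) (f : W → ℤ) :
    π.actDiv g (Y.divMap f) = Y.divMap (f ∘ g.1.1.symm) := by
  simp only [divMap, LinearMap.sum_apply, LinearMap.smulRight_apply, LinearMap.proj_apply, map_sum,
    map_smul, actDiv, Finsupp.lmapDomain_apply, Finsupp.mapDomain_single, Function.comp]
  refine Fintype.sum_equiv g.1.1 _ _ fun w => ?_
  rw [Equiv.symm_apply_apply]
  congr 1
  refine Fintype.sum_equiv g.1.1 _ _ fun w' => ?_
  rw [deck_rho]

theorem actDiv_mem_divZero (π : Cover Y X) (g : π.Deck) (D : Y.Div) (hD : D ∈ Y.DivZero) :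
    π.actDiv g D ∈ Y.DivZero := by
  have h : Y.deg ∘ₗ π.actDiv g = Y.deg := by
    ext w
    simp [deg, actDiv]
  rw [DivZero, LinearMap.mem_ker] at *
  rw [← LinearMap.comp_apply, h, hD]

/-- The action of an automorphism on the Jacobian, `g • [D] = [g • D]`. -/
noncomputable def actJac [Fintype W] (π : Cover Y X) (g : π.Deck) : Y.Jac →ₗ[ℤ] Y.Jac :=
  Submodule.mapQ _ _ ((π.actDiv g).restrict (π.actDiv_mem_divZero g)) <| by
    rintro ⟨D, hD⟩ ⟨f, hf⟩
    exact ⟨f ∘ g.1.1.symm, by rw [← actDiv_divMap, hf]; rfl⟩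

/-- Multiplication by the norm element `N_G = ∑_{g ∈ G} g` on the Jacobian. -/
noncomputable def normJac [Fintype W] [Finite F] (π : Cover Y X) : Y.Jac →ₗ[ℤ] Y.Jac :=
  ∑ g : π.Deck, π.actJac g

/-- `Jac⁰(Y) = {[D] | N_G • [D] = 0}`. -/
noncomputable def JacZero [Fintype W] [Finite F] (π : Cover Y X) : Submodule ℤ Y.Jac :=
  LinearMap.ker π.normJac

/-! ### Frobenius automorphisms and `L`-functions -/

/-- `g` is a Frobenius automorphism at the prime `p` of `X`: some prime path in the class `p` lifts
to a path of `Y`, from a vertex `w` to a vertex `w'`, such that `g w = w'`. -/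
def IsFrobenius (π : Cover Y X) (p : X.Prime) (g : π.Deck) : Prop :=
  ∃ (w w' : W) (l : List Y.Dart), Y.IsWalk w l w' ∧ ((l.map π.dart : List X.Dart) : Cycle X.Dart) = p.1
    ∧ g.1.1 w = w'

/-- The Frobenius automorphism `((Y/X)/p)`; for an abelian cover it exists and depends on `p`
only. -/
noncomputable def frob (π : Cover Y X) (p : X.Prime) : π.Deck :=
  Classical.epsilon (π.IsFrobenius p)

/-- The Euler factor `(1 - χ(Frob_p) u^{ν(p)})⁻¹`, as a formal power series in `u`. -/
noncomputable def eulerFactor (π : Cover Y X) (χ : π.Deck →* ℂˣ) (p : X.Prime) : PowerSeries ℂ :=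
  (1 - PowerSeries.C (χ (π.frob p) : ℂ) * PowerSeries.X ^ p.length)⁻¹

/-- The Artin-Ihara `L`-function `L_{Y/X}(u, χ)`, a formal infinite product over the primes of
`X` (in the topology of coefficientwise convergence). -/
noncomputable def artinL (π : Cover Y X) (χ : π.Deck →* ℂˣ) : PowerSeries ℂ :=
  ∏' p : X.Prime, π.eulerFactor χ p

/-- `L_{Y/X}(u, χ)⁻¹` is given by the polynomial `P` in `u`. -/
def IsLInverse (π : Cover Y X) (χ : π.Deck →* ℂˣ) (P : Polynomial ℂ) : Prop :=
  (P : PowerSeries ℂ) = (π.artinL χ)⁻¹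

open Classical in
/-- The special value `L*_{Y/X}(1, χ)`: the first nonzero coefficient of the Taylor expansion at
`u = 1` of `L_{Y/X}(u, χ)⁻¹`, which is a polynomial. -/
noncomputable def LStar (π : Cover Y X) (χ : π.Deck →* ℂˣ) : ℂ :=
  if h : ∃ P : Polynomial ℂ, π.IsLInverse χ P
  then (Polynomial.taylor 1 h.choose).trailingCoeff else 0

/-! ### The equivariant special value -/

/-- The augmentation ideal `I_G` of `ℤ[G]`. -/
noncomputable def augIdeal (π : Cover Y X) : Ideal (MonoidAlgebra ℤ π.Deck) :=
  RingHom.ker (MonoidAlgebra.lift ℤ ℤ π.Deck (1 : π.Deck →* ℤ))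

variable [Finite W] [Finite F]

noncomputable instance (π : Cover Y X) : Fintype (π.Deck →* ℂˣ) := Fintype.ofFinite _

/-- The idempotent `e_χ = |G|⁻¹ ∑_σ χ(σ) σ⁻¹` of `ℂ[G]`. -/
noncomputable def idem (π : Cover Y X) (χ : π.Deck →* ℂˣ) : MonoidAlgebra ℂ π.Deck :=
  (1 / (Nat.card π.Deck : ℂ)) • ∑ σ : π.Deck, MonoidAlgebra.single σ⁻¹ (χ σ : ℂ)

/-- `θ*_{Y/X}(1) = ∑_χ L*_{Y/X}(1, χ) e_{χ̄}`, where `χ̄ = χ⁻¹` is the conjugate character. -/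
noncomputable def thetaStar (π : Cover Y X) : MonoidAlgebra ℂ π.Deck :=
  ∑ χ : π.Deck →* ℂˣ, π.LStar χ • π.idem χ⁻¹

/-- The element `θ*_{Y/X}(1) e`, with `e = 1 - e_{χ₁}` and `χ₁` the trivial character. -/
noncomputable def thetaStarE (π : Cover Y X) : MonoidAlgebra ℂ π.Deck :=
  π.thetaStar * (1 - π.idem 1)

end Cover

end Multigraph

/-! ### Index computations in finitely generated free abelian groups -/

section Index

variable {M : Type*} [AddCommGroup M]

/-! On divisors N_G is pushforward to X followed by pullback to Y. Pushforward is onto and pullback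
is injective on Jacobians, so the norm on Jac(Y) has kernel Jac⁰(Y) and image a copy of Jac(X)
(`natCard_jacZero_mul`). The matrix-tree theorem turns orders of Jacobians into κ: with L the
Laplacian and J the all-ones matrix, det(L + J) is |V|²|Jac| up to sign by an index computation, and
|V|²κ by Cauchy–Binet (`natCard_jac`).

A section of the vertices makes Y the derived graph of a voltage assignment γ on X with values in G,
and χ(Frob) becomes the product of the weights χ(γ(b)) along the prime. The Euler product is then
1/det(1 − uW), with W the weighted non-backtracking edge matrix: both sides have logarithmic
derivative with coefficients tr Wᵐ, since closed non-backtracking walks are powers of primes with a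
starting point (`hasProd_euler`). Bass's formula reduces det(1 − uW) to a determinant of size |V|,
which at u = 1 is the determinant of the twisted Laplacian L_χ. As 1 − u² has leading coefficient −2
at u = 1, this gives L*(1, χ) = (−2)^(|E|−|V|) det L_χ whenever det L_χ ≠ 0
(`trailingCoeff_taylor_charpolyRev_edgeMat`).

The Laplacian with group ring entries has a determinant η in I_G with these character values up to χ
↦ χ⁻¹ (`exists_charEval_eq_det`), so θ*e is a power of −2 times η and is integral. For t in I_G
killed by no nontrivial character, |G|·|I_G/(t)| = ∏_{χ≠1}|χ(t)| (`relIndex_span_mul_card`). Finally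
det(L_Y + J) is block circulant over G and factors over the characters, whence κ_X ∏_{χ≠1} det L_χ =
|G| κ_Y (`prod_det_lapMat`). This shows both that no factor vanishes and what the index is. -/

theorem AddSubgroup.index_ker_sup_zmultiples (ε : M →+ ℤ) (hε : Function.Surjective ε) (ν : M) :
    (ε.ker ⊔ AddSubgroup.zmultiples ν).index = (ε ν).natAbs := by
  have h : ε.ker ⊔ AddSubgroup.zmultiples ν = (AddSubgroup.zmultiples (ε ν)).comap ε := by
    rw [← AddMonoidHom.map_zmultiples, AddSubgroup.comap_map_eq, sup_comm]
  rw [h, AddSubgroup.index_comap_of_surjective _ hε, Int.index_zmultiples]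

/-- If `φ : M → M` has image in the kernel of `ε : M → ℤ` and its kernel is generated by `ν`, then
the endomorphism `x ↦ φ x + ε x • ν` has cokernel of order `(ε ν)² |ker ε / φ M|`. -/
theorem AddMonoidHom.index_range_add_smul (φ : M →+ M) (ε : M →+ ℤ)
    (hε : Function.Surjective ε) (ν : M) (hφ : ∀ x, ε (φ x) = 0)
    (hker : φ.ker = AddSubgroup.zmultiples ν) (hν : ε ν ≠ 0) (ψ : M →+ M)
    (hψ : ∀ x, ψ x = φ x + ε x • ν) :
    ψ.range.index = (ε ν).natAbs ^ 2 * φ.range.relIndex ε.ker := by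
  have hRK : φ.range ≤ ε.ker := by
    rintro _ ⟨x, rfl⟩
    exact hφ x
  have hT : φ.range ⊔ ψ.range = φ.range ⊔ AddSubgroup.zmultiples ν := by
    apply le_antisymm
    · refine sup_le le_sup_left ?_
      rintro _ ⟨x, rfl⟩
      rw [hψ]
      exact AddSubgroup.add_mem_sup ⟨x, rfl⟩ ⟨ε x, rfl⟩
    · refine sup_le le_sup_left ?_
      rw [AddSubgroup.zmultiples_le]
      obtain ⟨x, hx⟩ := hε 1
      have : ν = φ (-x) + ψ x := by simp [hψ, hx]
      rw [this]
      exact AddSubgroup.add_mem_sup ⟨-x, rfl⟩ ⟨x, rfl⟩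
  -- Second isomorphism theorem: this is the index of ψM ∩ φM = φ(ker ε) in φM. Pulled back along φ
  -- it is the index of ker ε + ker φ in M.
  have h1 : ψ.range.relIndex (φ.range ⊔ ψ.range) = (ε ν).natAbs := by
    rw [AddSubgroup.relIndex_sup_right, ← AddSubgroup.inf_relIndex_right]
    have : ψ.range ⊓ φ.range = ε.ker.map φ := by
      ext y
      constructor
      · rintro ⟨⟨x, rfl⟩, ⟨z, hz⟩⟩
        have hx : ε x = 0 := by
          have := congrArg ε hz
          rw [hφ, hψ, map_add, hφ, map_zsmul, smul_eq_mul, zero_add] at this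
          exact (mul_eq_zero.1 this.symm).resolve_right hν
        exact ⟨x, hx, by simp [hψ, hx]⟩
      · rintro ⟨x, hx, rfl⟩
        have hx : ε x = 0 := hx
        exact ⟨⟨x, by simp [hψ, hx]⟩, ⟨x, rfl⟩⟩
    rw [this, AddMonoidHom.range_eq_map, AddSubgroup.relIndex_map_map, top_sup_eq,
      AddSubgroup.relIndex_top_right, hker, AddSubgroup.index_ker_sup_zmultiples ε hε]
  have h2 : (φ.range ⊔ ψ.range).index = (ε ν).natAbs * φ.range.relIndex ε.ker := by
    rw [hT]
    set T := φ.range ⊔ AddSubgroup.zmultiples ν with hTdef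
    -- The index of T splits into that of T ∩ ker ε in ker ε and that of T + ker ε in M.
    have hTK : T ⊓ ε.ker = φ.range := by
      apply le_antisymm
      · rintro y ⟨hy, hyK⟩
        obtain ⟨r, ⟨x, rfl⟩, z, ⟨k, rfl⟩, rfl⟩ := AddSubgroup.mem_sup.1 hy
        have hyK : ε (φ x + k • ν) = 0 := hyK
        rw [map_add, hφ, map_zsmul, smul_eq_mul, zero_add] at hyK
        have hk := (mul_eq_zero.1 hyK).resolve_right hν
        exact ⟨x, by simp [hk]⟩
      · exact le_inf le_sup_left hRK
    have hsup : ε.ker ⊔ T = ε.ker ⊔ AddSubgroup.zmultiples ν := by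
      rw [hTdef, ← sup_assoc, sup_eq_left.2 hRK]
    rw [← AddSubgroup.relIndex_mul_index (le_sup_right : T ≤ ε.ker ⊔ T),
      AddSubgroup.relIndex_sup_right, ← AddSubgroup.inf_relIndex_right, hTK, hsup,
      AddSubgroup.index_ker_sup_zmultiples ε hε, mul_comm]
  rw [← AddSubgroup.relIndex_mul_index (le_sup_right : ψ.range ≤ φ.range ⊔ ψ.range), h1, h2]
  ring

/-- The cokernel of an injective endomorphism of a lattice has order `|det|`. -/
theorem LinearMap.natAbs_det_eq_index [Module.Free ℤ M] [Module.Finite ℤ M] (f : M →ₗ[ℤ] M)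
    (hf : Function.Injective f) :
    f.det.natAbs = f.toAddMonoidHom.range.index := by
  have h := Submodule.natAbs_det_equiv (LinearMap.range f) (LinearEquiv.ofInjective f hf)
  have h2 : (LinearMap.range f).subtype ∘ₗ
      AddMonoidHom.toIntLinearMap ((LinearEquiv.ofInjective f hf : M ≃ₗ[ℤ] _) : M →+ _) = f := by
    ext x; rfl
  rw [h2] at h
  rw [h]
  rfl

/-- `LinearMap.natAbs_det_eq_index` for the map `x ↦ φ x + ε x • ν`, which is injective. -/
theorem LinearMap.natAbs_det_add_smul [Module.Free ℤ M] [Module.Finite ℤ M] (φ : M →ₗ[ℤ] M)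
    (ε : M →ₗ[ℤ] ℤ) (hε : Function.Surjective ε) (ν : M) (hφ : ∀ x, ε (φ x) = 0)
    (hker : ∀ x, φ x = 0 ↔ ∃ k : ℤ, x = k • ν) (hν : ε ν ≠ 0) :
    (φ + ε.smulRight ν).det.natAbs =
      (ε ν).natAbs ^ 2 * φ.toAddMonoidHom.range.relIndex ε.toAddMonoidHom.ker := by
  rw [LinearMap.natAbs_det_eq_index]
  · refine AddMonoidHom.index_range_add_smul φ.toAddMonoidHom ε.toAddMonoidHom hε ν hφ ?_ hν _
      fun x => rfl
    ext x
    rw [AddMonoidHom.mem_ker, AddSubgroup.mem_zmultiples_iff]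
    exact (hker x).trans ⟨fun ⟨k, hk⟩ => ⟨k, hk.symm⟩, fun ⟨k, hk⟩ => ⟨k, hk.symm⟩⟩
  · rw [injective_iff_map_eq_zero]
    intro x hx
    have hx' : φ x + ε x • ν = 0 := hx
    have h1 : ε x = 0 := by
      have := congrArg ε hx'
      rw [map_add, hφ, map_smul, smul_eq_mul, zero_add, map_zero] at this
      exact (mul_eq_zero.1 this).resolve_right hν
    rw [h1, zero_smul, add_zero] at hx'
    obtain ⟨k, rfl⟩ := (hker x).1 hx'
    rw [map_smul, smul_eq_mul] at h1
    rw [(mul_eq_zero.1 h1).resolve_right hν, zero_smul]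

end Index

namespace Multigraph

variable {V E W F : Type*}

/-! ### Walks -/

section Walks

variable (X : Multigraph V E)

@[simp] theorem inv_inv (a : X.Dart) : X.inv (X.inv a) = a := by simp [inv]

@[simp] theorem init_inv (a : X.Dart) : X.init (X.inv a) = X.term a := by
  rcases a with ⟨e, _ | _⟩ <;> rfl

@[simp] theorem term_inv (a : X.Dart) : X.term (X.inv a) = X.init a := by
  rcases a with ⟨e, _ | _⟩ <;> rfl

theorem eq_or_eq_inv_of_fst_eq {a b : X.Dart} (h : a.1 = b.1) : b = a ∨ b = X.inv a := by
  rcases a with ⟨e, _ | _⟩ <;> rcases b with ⟨f, _ | _⟩ <;> simp_all [inv]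

/-- Reversal of orientation as a permutation of the oriented edges. -/
def invEquiv : Equiv.Perm X.Dart where
  toFun := X.inv
  invFun := X.inv
  left_inv := X.inv_inv
  right_inv := X.inv_inv

@[simp] theorem invEquiv_apply (a : X.Dart) : X.invEquiv a = X.inv a := rfl

theorem isWalk_append {v w : V} {l m : List X.Dart} :
    X.IsWalk v (l ++ m) w ↔ ∃ u, X.IsWalk v l u ∧ X.IsWalk u m w := by
  induction l generalizing v with
  | nil => simp [IsWalk]
  | cons a l ih => simp [IsWalk, ih, and_assoc]

theorem IsWalk.append {u v w : V} {l m : List X.Dart} (h : X.IsWalk u l v) (h' : X.IsWalk v m w) :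
    X.IsWalk u (l ++ m) w :=
  X.isWalk_append.2 ⟨v, h, h'⟩

theorem IsWalk.reverse {v w : V} {l : List X.Dart} (h : X.IsWalk v l w) :
    X.IsWalk w (l.map X.inv).reverse v := by
  induction l generalizing v with
  | nil => exact h.symm
  | cons a l ih =>
    rw [List.map_cons, List.reverse_cons]
    exact (ih h.2).append X ⟨by simp, by simp [h.1, IsWalk]⟩

variable {X}

/-- A property which propagates along the oriented edges over `T` holds everywhere as soon as it
holds somewhere. -/
theorem IsWalk.induction {T : Set E} {P : V → Prop}
    (hP : ∀ a : X.Dart, a.1 ∈ T → P (X.init a) → P (X.term a)) {v w : V} {l : List X.Dart}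
    (hl : X.IsWalk v l w) (hT : ∀ a ∈ l, a.1 ∈ T) (hv : P v) : P w := by
  induction l generalizing v with
  | nil => exact hl ▸ hv
  | cons a l ih =>
    refine ih hl.2 (fun b hb => hT b (List.mem_cons_of_mem _ hb)) (hP a (hT a List.mem_cons_self) ?_)
    rw [hl.1]
    exact hv

theorem ConnectedBy.induction {T : Set E} (hT : X.ConnectedBy T) {P : V → Prop}
    (hP : ∀ a : X.Dart, a.1 ∈ T → P (X.init a) → P (X.term a)) {v : V} (hv : P v) (w : V) :
    P w := by
  obtain ⟨l, hl, hw⟩ := hT.2 v w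
  exact hw.induction hP hl hv

/-- `T'` connects the multigraph if it connects the end points of every edge in a set `T` that
does. -/
theorem ConnectedBy.trans {T T' : Set E} (hT : X.ConnectedBy T)
    (h : ∀ e ∈ T, ∃ l : List X.Dart, (∀ a ∈ l, a.1 ∈ T') ∧ X.IsWalk (X.src e) l (X.tgt e)) :
    X.ConnectedBy T' := by
  refine ⟨hT.1, fun v w => hT.induction
    (P := fun w => ∃ l : List X.Dart, (∀ a ∈ l, a.1 ∈ T') ∧ X.IsWalk v l w) ?_
    ⟨[], by simp, rfl⟩ w⟩
  rintro ⟨e, b⟩ he ⟨l, hl, hw⟩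
  obtain ⟨m, hm, hm'⟩ := h e he
  cases b
  · refine ⟨l ++ (m.map X.inv).reverse, ?_, hw.append X (hm'.reverse X)⟩
    intro a ha
    rcases List.mem_append.1 ha with ha | ha
    · exact hl a ha
    · obtain ⟨b, hb, rfl⟩ := List.mem_map.1 (List.mem_reverse.1 ha)
      exact hm b hb
  · refine ⟨l ++ m, ?_, hw.append X hm'⟩
    intro a ha
    rcases List.mem_append.1 ha with ha | ha
    · exact hl a ha
    · exact hm a ha

end Walks

/-! ### Twisted Laplacians -/

section Laplacian

variable [Fintype V] [Fintype E] [DecidableEq V] (X : Multigraph V E) {R : Type*} [CommRing R]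

/-- The adjacency matrix in which the oriented edge `a` has weight `c a`. -/
def adjMat (c : X.Dart → R) : Matrix V V R :=
  fun v w => ∑ a, if X.init a = v ∧ X.term a = w then c a else 0

/-- The degree matrix. -/
noncomputable def degMat (R : Type*) [CommRing R] : Matrix V V R :=
  Matrix.diagonal fun v => (X.degree v : R)

/-- The Laplacian in which the oriented edge `a` has weight `c a`. -/
noncomputable def lapMat (c : X.Dart → R) : Matrix V V R := X.degMat R - X.adjMat c

omit [Fintype V] in
theorem degree_eq_sum (v : V) : (X.degree v : R) = ∑ a, if X.init a = v then 1 else 0 := by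
  rw [degree, Nat.card_eq_fintype_card, Fintype.card_subtype, Finset.sum_boole]

omit [Fintype V] in
theorem degree_eq_sum_term (v : V) : (X.degree v : R) = ∑ a, if X.term a = v then 1 else 0 := by
  rw [degree_eq_sum]
  exact Fintype.sum_equiv X.invEquiv _ _ fun a => by simp

omit [Fintype V] in
theorem adjMat_one_apply (v w : V) :
    X.adjMat (1 : X.Dart → R) v w = ∑ e, ((if X.src e = v ∧ X.tgt e = w then 1 else 0) +
      if X.tgt e = v ∧ X.src e = w then 1 else 0) := by
  rw [adjMat, Fintype.sum_prod_type]
  exact Finset.sum_congr rfl fun e _ => by rw [Fintype.sum_bool]; simp [init, term]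

omit [Fintype V] in
-- Both orientations of a loop contribute to the diagonal of `adjMat`, which accounts for the term 2
-- · `loops` in `rho`.
theorem rho_eq_lapMat (v w : V) : X.rho v w = X.lapMat (1 : X.Dart → ℤ) v w := by
  rw [rho, lapMat, Matrix.sub_apply, adjMat_one_apply, degMat]
  split_ifs with h
  · subst h
    have : (X.loops v : ℤ) = ∑ e, if X.src e = v ∧ X.tgt e = v then 1 else 0 := by
      rw [loops, Nat.card_eq_fintype_card, Fintype.card_subtype, Finset.sum_boole]
      simp [ends]
    rw [Matrix.diagonal_apply_eq, Finset.sum_add_distrib, this]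
    simp only [and_comm, two_mul]
  · have : (X.edgesBetween v w : ℤ) = ∑ e, ((if X.src e = v ∧ X.tgt e = w then 1 else 0) +
      if X.tgt e = v ∧ X.src e = w then 1 else 0) := by
      rw [edgesBetween, Nat.card_eq_fintype_card, Fintype.card_subtype, ← Finset.sum_boole]
      refine Finset.sum_congr rfl fun e _ => ?_
      simp only [ends, Sym2.eq_iff]
      by_cases h1 : X.src e = v <;> by_cases h2 : X.tgt e = w <;> by_cases h3 : X.tgt e = v <;>
        by_cases h4 : X.src e = w <;> simp_all
    rw [Matrix.diagonal_apply_ne _ h, this, zero_sub]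

theorem divMap_apply (f : V → ℤ) (v : V) :
    X.divMap f v = (X.lapMat (1 : X.Dart → ℤ)).mulVec f v := by
  simp only [divMap, LinearMap.sum_apply, LinearMap.smulRight_apply, LinearMap.proj_apply,
    Finsupp.finsetSum_apply, Finsupp.smul_apply, Matrix.mulVec, dotProduct, smul_eq_mul,
    ← rho_eq_lapMat]
  refine Finset.sum_congr rfl fun w _ => ?_
  rw [Finset.sum_eq_single v (fun u _ hu => Finsupp.single_eq_of_ne' hu) (by simp),
    Finsupp.single_eq_same, mul_comm]

theorem adjMat_mulVec (c : X.Dart → R) (f : V → R) (v : V) :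
    (X.adjMat c).mulVec f v = ∑ a, if X.init a = v then c a * f (X.term a) else 0 := by
  simp only [adjMat, Matrix.mulVec, dotProduct, Finset.sum_mul]
  rw [Finset.sum_comm]
  refine Finset.sum_congr rfl fun a _ => ?_
  rw [Finset.sum_eq_single (X.term a)] <;> aesop

theorem lapMat_one_mulVec (f : V → R) (v : V) :
    (X.lapMat (1 : X.Dart → R)).mulVec f v =
      ∑ a, if X.init a = v then f v - f (X.term a) else 0 := by
  rw [lapMat, Matrix.sub_mulVec, Pi.sub_apply, adjMat_mulVec, degMat, Matrix.mulVec_diagonal,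
    degree_eq_sum, Finset.sum_mul, ← Finset.sum_sub_distrib]
  exact Finset.sum_congr rfl fun a _ => by split_ifs <;> simp

theorem divMap_apply' (f : V → ℤ) (v : V) :
    X.divMap f v = ∑ a, if X.init a = v then f v - f (X.term a) else 0 := by
  rw [divMap_apply, lapMat_one_mulVec]

theorem sum_lapMat_one (w : V) : ∑ v, X.lapMat (1 : X.Dart → R) v w = 0 := by
  simp only [lapMat, Matrix.sub_apply, Finset.sum_sub_distrib, degMat, adjMat]
  rw [Finset.sum_comm, Finset.sum_eq_single w (fun u _ hu => Matrix.diagonal_apply_ne _ hu)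
    (by simp), Matrix.diagonal_apply_eq, degree_eq_sum_term, sub_eq_zero]
  refine Finset.sum_congr rfl fun a _ => ?_
  rw [Finset.sum_eq_single (X.init a)] <;> aesop

omit [Fintype V] [Fintype E] [DecidableEq V] in
theorem deg_eq_sum [Fintype V] (D : X.Div) : X.deg D = ∑ v, D v := by
  rw [deg, Finsupp.lsum_apply, Finsupp.sum_fintype _ _ (by simp)]
  rfl

omit [Fintype E] [DecidableEq V] in
theorem deg_divMap [Finite E] (f : V → ℤ) : X.deg (X.divMap f) = 0 := by
  classical
  have := Fintype.ofFinite E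
  simp only [deg_eq_sum, divMap_apply, Matrix.mulVec, dotProduct]
  rw [Finset.sum_comm]
  simp [← Finset.sum_mul, sum_lapMat_one]

omit [Fintype E] [DecidableEq V] in
/-- On a connected multigraph the functions with trivial divisor are the constants. -/
theorem divMap_eq_zero_iff [Finite E] (hX : X.Connected) (f : V → ℤ) :
    X.divMap f = 0 ↔ ∃ k, ∀ v, f v = k := by
  classical
  have := Fintype.ofFinite E
  constructor
  · intro h
    have := hX.1
    -- Maximum principle: where f is maximal, the Laplacian is a vanishing sum of nonnegative
    -- differences, so all neighbours take the same value.
    obtain ⟨v₀, hv₀⟩ := Finite.exists_max f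
    refine ⟨f v₀, hX.induction (P := fun v => f v = f v₀) ?_ rfl⟩
    intro a _ ha
    have h1 := DFunLike.congr_fun h (X.init a)
    rw [divMap_apply', Finsupp.coe_zero, Pi.zero_apply,
      Finset.sum_eq_zero_iff_of_nonneg] at h1
    · have := h1 a (Finset.mem_univ _)
      rw [if_pos rfl] at this
      linarith
    · intro b _
      split_ifs
      · have := hv₀ (X.term b)
        linarith
      · exact le_rfl
  · rintro ⟨k, hk⟩
    ext v
    simp [divMap_apply', hk]

omit [Fintype E] [DecidableEq V] in
theorem natCard_jac_eq_relIndex :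
    Nat.card X.Jac = X.Pr.toAddSubgroup.relIndex X.DivZero.toAddSubgroup := rfl

/-- The determinant of the Laplacian plus the all-ones matrix is `|V|² |Jac(X)|`, up to sign. -/
theorem natAbs_det_lapMat_add_one (hX : X.Connected) :
    (X.lapMat (1 : X.Dart → ℤ) + Matrix.of fun _ _ => 1).det.natAbs =
      Fintype.card V ^ 2 * Nat.card X.Jac := by
  have := hX.1
  let ν : X.Div := Finsupp.equivFunOnFinite.symm fun _ => 1
  have hν : X.deg ν = Fintype.card V := by simp [deg_eq_sum, ν]
  -- Identifying functions with divisors makes `divMap` an endomorphism whose kernel is generated by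
  -- the all-ones divisor ν. Then x ↦ φ x + deg(x) ν has matrix L + J.
  let φ : X.Div →ₗ[ℤ] X.Div := X.divMap ∘ₗ (Finsupp.linearEquivFunOnFinite ℤ ℤ V).toLinearMap
  have hφ (D) : φ D = X.divMap D := rfl
  have h := LinearMap.natAbs_det_add_smul φ X.deg (fun k => by
    obtain ⟨v⟩ := hX.1
    exact ⟨Finsupp.single v k, by simp [deg]⟩) ν (fun D => X.deg_divMap _) (fun D => by
    rw [hφ, X.divMap_eq_zero_iff hX]
    refine exists_congr fun k => ⟨fun h => ?_, fun h v => ?_⟩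
    · ext v
      simp [ν, h v]
    · simp [h, ν]) (by rw [hν]; exact_mod_cast Fintype.card_ne_zero)
  have hr : φ.toAddMonoidHom.range = X.Pr.toAddSubgroup := by
    have : LinearMap.range φ = X.Pr := LinearMap.range_comp_of_range_eq_top _ (LinearEquiv.range _)
    rw [← this]
    rfl
  rw [natCard_jac_eq_relIndex, ← hr]
  rw [hν, Int.natAbs_natCast] at h
  refine Eq.trans ?_ h
  rw [← LinearMap.det_toMatrix (Finsupp.basisSingleOne (ι := V) (R := ℤ))]
  congr 2
  ext v w
  rw [LinearMap.toMatrix_apply]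
  have : X.deg (Finsupp.single w 1) = 1 := by simp [deg]
  simp only [Finsupp.coe_basisSingleOne, LinearMap.add_apply, LinearMap.smulRight_apply,
    Finsupp.basisSingleOne_repr, LinearEquiv.refl_apply, Finsupp.add_apply, hφ, this, one_smul,
    divMap_apply, Matrix.add_apply, Matrix.of_apply]
  simp [ν, Matrix.mulVec, dotProduct, Finsupp.single_apply]

end Laplacian

end Multigraph

namespace Multigraph

variable {V E W F : Type*}

/-! ### Spanning trees -/

section SpanningTree

variable {X : Multigraph V E}

/-- The simple graph in which the distinct end points of edges in `T` are adjacent. -/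
def simpleGraph (X : Multigraph V E) (T : Set E) : SimpleGraph V :=
  SimpleGraph.fromEdgeSet (X.ends '' T)

theorem connected_simpleGraph {T : Set E} (hT : X.ConnectedBy T) : (X.simpleGraph T).Connected := by
  have := hT.1
  refine SimpleGraph.Connected.mk fun v w =>
    hT.induction (P := fun w => (X.simpleGraph T).Reachable v w) ?_ SimpleGraph.Reachable.rfl w
  rintro a ha h
  by_cases hne : X.init a = X.term a
  · rwa [← hne]
  · refine h.trans (SimpleGraph.Adj.reachable ?_)
    refine (SimpleGraph.fromEdgeSet_adj _).2 ⟨⟨a.1, ha, ?_⟩, hne⟩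
    rcases a with ⟨e, _ | _⟩
    · exact Sym2.eq_swap
    · rfl

theorem exists_isWalk_of_ends_eq {e : E} {v w : V} (h : X.ends e = s(v, w)) :
    ∃ a : X.Dart, a.1 = e ∧ X.init a = v ∧ X.term a = w := by
  rcases Sym2.eq_iff.1 h with ⟨h1, h2⟩ | ⟨h1, h2⟩
  · exact ⟨(e, true), rfl, h1, h2⟩
  · exact ⟨(e, false), rfl, h2, h1⟩

theorem connectedBy_of_simpleGraph {T : Set E} {H : SimpleGraph V} (hH : H.Connected)
    (h : H.edgeSet ⊆ X.ends '' T) : X.ConnectedBy T := by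
  refine ⟨hH.nonempty, fun v w => ?_⟩
  obtain ⟨p⟩ := hH.preconnected v w
  induction p with
  | nil => exact ⟨[], by simp, rfl⟩
  | cons hadj p ih =>
    obtain ⟨l, hl, hw⟩ := ih
    obtain ⟨e, he, hee⟩ := h (H.mem_edgeSet.2 hadj)
    obtain ⟨a, rfl, h1, h2⟩ := exists_isWalk_of_ends_eq hee
    refine ⟨a :: l, ?_, h1, h2 ▸ hw⟩
    intro b hb
    rcases List.mem_cons.1 hb with rfl | hb
    · exact he
    · exact hl b hb

/-- Passing to the simple graph drops loops and merges parallel edges, so the bound for connected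
simple graphs applies. -/
theorem ConnectedBy.card_le [Finite E] {T : Set E} (hT : X.ConnectedBy T) :
    Nat.card V ≤ T.ncard + 1 := by
  refine (connected_simpleGraph hT).card_vert_le_card_edgeSet_add_one.trans
    (Nat.add_le_add_right ?_ 1)
  rw [Nat.card_coe_set_eq]
  refine (Set.ncard_le_ncard (t := X.ends '' T) ?_ (Set.toFinite _)).trans
    (Set.ncard_image_le (Set.toFinite _))
  rw [simpleGraph, SimpleGraph.edgeSet_fromEdgeSet]
  exact Set.sdiff_subset

/-- Choose one edge of T above each edge of a spanning tree of the associated simple graph. -/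
theorem ConnectedBy.exists_subset_ncard [Finite V] [Finite E] {T : Set E} (hT : X.ConnectedBy T) :
    ∃ T' ⊆ T, X.ConnectedBy T' ∧ T'.ncard + 1 = Nat.card V := by
  obtain ⟨H, hH, htree⟩ := (connected_simpleGraph hT).exists_isTree_le
  have hsub : ∀ s : H.edgeSet, s.1 ∈ X.ends '' T := by
    intro s
    have := SimpleGraph.edgeSet_mono hH s.2
    rw [simpleGraph, SimpleGraph.edgeSet_fromEdgeSet] at this
    exact this.1
  choose f hf hf' using hsub
  have hconn : X.ConnectedBy (f '' Set.univ) :=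
    connectedBy_of_simpleGraph htree.connected fun s hs =>
      ⟨f ⟨s, hs⟩, Set.mem_image_of_mem f trivial, hf' ⟨s, hs⟩⟩
  refine ⟨f '' Set.univ, ?_, hconn, le_antisymm ?_ hconn.card_le⟩
  · rintro _ ⟨s, -, rfl⟩
    exact hf s
  · rw [← (SimpleGraph.isTree_iff_connected_and_card.1 htree).2]
    refine Nat.add_le_add_right ((Set.ncard_image_le (Set.toFinite _)).trans ?_) 1
    rw [Set.ncard_univ]

/-- A walk of minimal length repeats no vertex, since the part between two visits could be cut out.
-/
theorem ConnectedBy.exists_path {T : Set E} (hT : X.ConnectedBy T) (v w : V) :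
    ∃ l : List X.Dart, (∀ a ∈ l, a.1 ∈ T) ∧ X.IsWalk v l w ∧ (v :: l.map X.term).Nodup := by
  classical
  have hex : ∃ n, ∃ l : List X.Dart, l.length = n ∧ (∀ a ∈ l, a.1 ∈ T) ∧ X.IsWalk v l w :=
    let ⟨l, hl⟩ := hT.2 v w
    ⟨l.length, l, rfl, hl⟩
  obtain ⟨l, hln, hl, hw⟩ := Nat.find_spec hex
  have hmin (m : List X.Dart) (hm : ∀ a ∈ m, a.1 ∈ T) (hm' : X.IsWalk v m w) :
      l.length ≤ m.length := hln ▸ Nat.find_min' hex ⟨m, rfl, hm, hm'⟩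
  clear hln hex
  refine ⟨l, hl, hw, ?_⟩
  induction l generalizing v with
  | nil => simp
  | cons a l ih =>
    have hlT (b) (hb : b ∈ l) : b.1 ∈ T := hl b (List.mem_cons_of_mem _ hb)
    refine List.nodup_cons.2 ⟨fun hv => ?_, ?_⟩
    · obtain ⟨b, hb, hbv⟩ := List.mem_map.1 hv
      obtain ⟨l₁, l₂, hl₁₂⟩ := List.append_of_mem hb
      rw [hl₁₂] at hw hmin hl
      obtain ⟨u, -, hu⟩ := X.isWalk_append.1 hw
      have := hmin l₂ (fun c hc => hl c (by simp [hc])) (hbv ▸ hu.2)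
      simp at this
      lia
    · refine ih (X.term a) hlT hw.2 fun m hm hm' => ?_
      have := hmin (a :: m) (by
        intro b hb
        rcases List.mem_cons.1 hb with rfl | hb
        · exact hl _ List.mem_cons_self
        · exact hm b hb) ⟨hw.1, hm'⟩
      simpa using this

/-- A second use of an edge would repeat its end point (same orientation) or return to its initial
point (opposite orientation). `IsCycle` requires both kinds of distinctness. -/
theorem IsWalk.nodup_fst {v w : V} {l : List X.Dart} (hw : X.IsWalk v l w)
    (hl : (v :: l.map X.term).Nodup) : (l.map Prod.fst).Nodup := by
  induction l generalizing v with
  | nil => simp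
  | cons a l ih =>
    rw [List.map_cons, List.nodup_cons] at hl
    refine List.nodup_cons.2 ⟨fun ha => ?_, ih hw.2 hl.2⟩
    obtain ⟨b, hb, hba⟩ := List.mem_map.1 ha
    rcases X.eq_or_eq_inv_of_fst_eq hba.symm with rfl | rfl
    · exact (List.nodup_cons.1 hl.2).1 (List.mem_map_of_mem hb)
    · refine hl.1 (List.mem_cons_of_mem _ (List.mem_map.2 ⟨_, hb, ?_⟩))
      rw [term_inv, hw.1]

/-- Spanning trees are the connected sets of `|V| - 1` edges. -/
theorem isSpanningTree_iff [Finite V] [Finite E] {T : Set E} :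
    X.IsSpanningTree T ↔ X.ConnectedBy T ∧ T.ncard + 1 = Nat.card V := by
  constructor
  · rintro ⟨hT, hcyc⟩
    refine ⟨hT, ?_⟩
    obtain ⟨T', hsub, hconn, hcard⟩ := hT.exists_subset_ncard
    suffices T' = T by rwa [← this]
    -- An edge of T outside T' closes up with a path in T' to a cycle in T.
    refine hsub.antisymm fun e he => by_contra fun he' => hcyc ?_
    obtain ⟨l, hl, hw, hnd⟩ := hconn.exists_path (X.tgt e) (X.src e)
    refine ⟨(e, true) :: l, ⟨⟨List.cons_ne_nil _ _, X.src e, rfl, hw⟩, ?_, hnd⟩, ?_⟩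
    · refine List.nodup_cons.2 ⟨fun h => ?_, hw.nodup_fst hnd⟩
      obtain ⟨a, ha, hae⟩ := List.mem_map.1 h
      have hae : a.1 = e := hae
      exact he' (hae ▸ hl a ha)
    · intro a ha
      rcases List.mem_cons.1 ha with rfl | ha
      · exact he
      · exact hsub (hl a ha)
  · rintro ⟨hT, hcard⟩
    refine ⟨hT, ?_⟩
    rintro ⟨l, ⟨⟨hne, v, hw⟩, hnd, -⟩, hl⟩
    obtain ⟨a, l, rfl⟩ := List.exists_cons_of_ne_nil hne
    have haT := hl a List.mem_cons_self
    have hl' : ∀ b ∈ l, b.1 ∈ T \ {a.1} := fun b hb =>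
      ⟨hl b (List.mem_cons_of_mem _ hb), fun h =>
        (List.nodup_cons.1 hnd).1 (List.mem_map.2 ⟨b, hb, h⟩)⟩
    have hw' : X.IsWalk (X.term a) l (X.init a) := hw.1 ▸ hw.2
    -- Removing an edge of a cycle keeps T connected, because the rest of the cycle replaces it; too
    -- few edges then remain.
    have hconn : X.ConnectedBy (T \ {a.1}) := by
      refine hT.trans fun e he => ?_
      by_cases hea : e = a.1
      · subst hea
        obtain ⟨e, _ | _⟩ := a
        · exact ⟨l, hl', hw'⟩
        · refine ⟨(l.map X.inv).reverse, fun b hb => ?_, hw'.reverse X⟩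
          obtain ⟨c, hc, rfl⟩ := List.mem_map.1 (List.mem_reverse.1 hb)
          exact hl' c hc
      · exact ⟨[(e, true)], by simpa using ⟨he, hea⟩, rfl, rfl⟩
    have h1 := hconn.card_le
    rw [← hcard, ← Set.ncard_sdiff_singleton_add_one haT] at h1
    lia

end SpanningTree

end Multigraph

/-! ### The Cauchy–Binet formula -/

/-- A form of the Cauchy–Binet formula, in which the sum is over all maps instead of over all
subsets of the right size. -/
theorem Matrix.factorial_mul_det_mul {m n R : Type*} [Fintype m] [Fintype n] [DecidableEq m]
    [DecidableEq n] [CommRing R] (A : Matrix n m R) (B : Matrix m n R) :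
    ((Fintype.card n).factorial : R) * (A * B).det =
      ∑ f : n → m, (A.submatrix id f).det * (B.submatrix f id).det := by
  have h1 : (A * B).det = ∑ f : n → m, (A.submatrix id f).det * ∏ i, B (f i) i := by
    simp only [Matrix.det_apply', Matrix.mul_apply, Finset.prod_univ_sum, Finset.mul_sum,
      Fintype.piFinset_univ, Finset.sum_mul, Matrix.submatrix_apply, id]
    rw [Finset.sum_comm]
    refine Finset.sum_congr rfl fun f _ => Finset.sum_congr rfl fun σ _ => ?_
    rw [Finset.prod_mul_distrib]
    ring
  -- Precomposing f with τ permutes the columns of the minor of A. Summing over all τ gives the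
  -- factorial on the left and assembles the minor of B on the right.
  have h2 (τ : Equiv.Perm n) : (A * B).det =
      ∑ f : n → m, (A.submatrix id f).det * (Equiv.Perm.sign τ * ∏ i, B (f (τ i)) i) := by
    rw [h1, ← Equiv.sum_comp (Equiv.arrowCongr τ.symm (Equiv.refl m))]
    refine Finset.sum_congr rfl fun f _ => ?_
    have : A.submatrix id (Equiv.arrowCongr τ.symm (Equiv.refl m) f) =
      (A.submatrix id f).submatrix id τ := rfl
    rw [this, Matrix.det_permute', mul_comm _ (A.submatrix id f).det, mul_assoc]
    rfl
  rw [← Fintype.card_perm, ← nsmul_eq_mul, ← Finset.card_univ, ← Finset.sum_const,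
    Finset.sum_congr rfl fun τ _ => h2 τ, Finset.sum_comm]
  refine Finset.sum_congr rfl fun f _ => ?_
  rw [← Finset.mul_sum, Matrix.det_apply' (B.submatrix f id)]
  rfl

/-- The number of bijections onto a set of the right size. -/
theorem Nat.card_injective_range_eq {α β : Type*} [Finite α] (S : Set β)
    (hS : S.ncard = Nat.card α) (hS' : S.Finite) :
    Nat.card {f : α → β // Function.Injective f ∧ Set.range f = S} = (Nat.card α).factorial := by
  classical
  have := Fintype.ofFinite α
  have := hS'.fintype
  let e : {f : α → β // Function.Injective f ∧ Set.range f = S} ≃ (α ≃ S) :=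
    { toFun f := (Equiv.ofInjective f.1 f.2.1).trans (Equiv.setCongr f.2.2)
      invFun g := ⟨fun a => g a, Subtype.val_injective.comp g.injective, by
        have := (g.surjective.range_comp (Subtype.val : S → β))
        rw [Subtype.range_val] at this
        exact this⟩
      left_inv f := rfl
      right_inv g := by ext; rfl }
  have hc : Nat.card α = Nat.card S := by rw [Nat.card_coe_set_eq, hS]
  rw [Nat.card_congr e, Nat.card_eq_fintype_card, Nat.card_eq_fintype_card]
  rw [Nat.card_eq_fintype_card, Nat.card_eq_fintype_card] at hc
  exact Fintype.card_equiv (Fintype.equivOfCardEq hc)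

namespace Multigraph

variable {V E W F : Type*}

/-! ### The matrix-tree theorem -/

section MatrixTree

variable [Fintype V] [Fintype E] [DecidableEq V] (X : Multigraph V E)

/-- The incidence matrix, extended by an additional column of ones. -/
def incMat : Matrix V (Option E) ℤ :=
  Matrix.of fun v o => o.elim 1 fun e =>
    (Pi.single (X.src e) 1 - Pi.single (X.tgt e) 1 : V → ℤ) v

omit [Fintype V] in
-- The incidence columns produce the Laplacian, and the column of ones produces J.
theorem incMat_mul_transpose :
    X.incMat * X.incMat.transpose = X.lapMat (1 : X.Dart → ℤ) + Matrix.of fun _ _ => 1 := by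
  ext v w
  rw [Matrix.mul_apply, Fintype.sum_option, add_comm, Matrix.add_apply, lapMat, Matrix.sub_apply,
    adjMat_one_apply]
  congr 1
  have : X.degMat ℤ v w = ∑ e, if v = w then ((if X.src e = v then 1 else 0) +
      if X.tgt e = v then 1 else 0) else 0 := by
    rw [degMat, Matrix.diagonal_apply, degree_eq_sum, Fintype.sum_prod_type]
    split_ifs
    · exact Finset.sum_congr rfl fun e _ => by rw [Fintype.sum_bool]; rfl
    · simp
  rw [this, ← Finset.sum_sub_distrib]
  refine Finset.sum_congr rfl fun e _ => ?_
  clear this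
  simp only [incMat, Matrix.transpose_apply, Matrix.of_apply, Option.elim_some, Pi.sub_apply,
    Pi.single_apply]
  by_cases h1 : v = X.src e <;> by_cases h2 : v = X.tgt e <;> by_cases h3 : w = X.src e <;>
    by_cases h4 : w = X.tgt e <;> by_cases h5 : v = w <;> simp_all [eq_comm]

omit [Fintype E] in
theorem vecMul_incMat_some (g : V → ℤ) (e : E) :
    ∑ v, g v * X.incMat v (some e) = g (X.src e) - g (X.tgt e) := by
  simp [incMat, mul_sub, Finset.sum_sub_distrib, Pi.single_apply]

variable {X}

omit [Fintype E] in
-- Two divisibilities, so that no expansion along leaves of a tree is needed: a right multiple of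
-- the minor has determinant |V|, and the sum of its rows is divisible by |V|.
theorem natAbs_det_incMat {f : V → Option E} {i : V} (hi : f i = none)
    (hf : X.ConnectedBy {e | some e ∈ Set.range f}) :
    (X.incMat.submatrix id f).det.natAbs = Fintype.card V := by
  set A := X.incMat.submatrix id f with hA
  have hcol (j : V) : A.mulVec (Pi.single j 1) = fun v => X.incMat v (f j) := by
    ext v
    simp [hA]
  refine Nat.dvd_antisymm ?_ ?_
  -- Summing edge columns along a walk from i to v. Adding column i, which consists of ones, gives a
  -- product A · C equal to 1 plus a rank-one matrix, of determinant |V|.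
  · have hspan (v : V) : ∃ x, A.mulVec x = Pi.single v 1 - Pi.single i 1 := by
      refine hf.induction (P := fun v => ∃ x, A.mulVec x = Pi.single v 1 - Pi.single i 1) ?_
        (v := i) ⟨0, by simp⟩ v
      rintro ⟨e, b⟩ ⟨j, hj⟩ ⟨x, hx⟩
      have hj' : A.mulVec (Pi.single j 1) = Pi.single (X.src e) 1 - Pi.single (X.tgt e) 1 := by
        rw [hcol, hj]
        rfl
      cases b
      · exact ⟨x + Pi.single j 1, by
          rw [Matrix.mulVec_add, hx, hj']
          simp [init, term]⟩
      · exact ⟨x - Pi.single j 1, by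
          rw [Matrix.mulVec_sub, hx, hj']
          simp [init, term]⟩
    choose C hC using hspan
    have h1 (v : V) : A.mulVec (C v + Pi.single i 1) = Pi.single v 1 - Pi.single i 1 + 1 := by
      rw [Matrix.mulVec_add, hC, hcol, hi]
      rfl
    have h2 : A * (Matrix.of fun u v => (C v + Pi.single i 1 : V → ℤ) u) =
        1 + Matrix.replicateCol Unit (1 - Pi.single i 1 : V → ℤ) *
          Matrix.replicateRow Unit (1 : V → ℤ) := by
      ext u v
      refine (congrFun (h1 v) u).trans ?_
      simp [Matrix.mul_apply, Matrix.one_apply, Pi.single_apply]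
      ring
    have h3 := congrArg Matrix.det h2
    rw [Matrix.det_mul, Matrix.det_one_add_replicateCol_mul_replicateRow] at h3
    have h4 : (1 : V → ℤ) ⬝ᵥ (1 - Pi.single i 1) = Fintype.card V - 1 := by
      simp [dotProduct, Finset.sum_sub_distrib]
    rw [h4, add_sub_cancel] at h3
    exact Int.natAbs_dvd_natAbs.2 ⟨_, h3.symm⟩
  -- Edge columns sum to 0 and columns of ones sum to |V|. Multiplying by the adjugate turns this
  -- into |V| ∣ det A.
  · have h1 : Matrix.vecMul 1 A = (Fintype.card V : ℤ) • fun j => if f j = none then 1 else 0 := by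
      ext j
      have hsum : Matrix.vecMul 1 A j = ∑ v, (1 : V → ℤ) v * X.incMat v (f j) := rfl
      rw [hsum]
      cases hj : f j with
      | none => simp [incMat, hj]
      | some e => rw [vecMul_incMat_some]; simp [hj]
    have h2 := congrFun (congrArg (fun x => Matrix.vecMul x A.adjugate) h1) i
    simp only [Matrix.vecMul_vecMul, Matrix.mul_adjugate, Matrix.vecMul_smul, Matrix.vecMul_one,
      Matrix.smul_vecMul, Pi.smul_apply, Pi.one_apply, smul_eq_mul, mul_one] at h2
    exact Int.natCast_dvd.1 ⟨_, h2⟩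

omit [Fintype E] in
theorem connectedBy_of_det_incMat_ne_zero [Nonempty V] {f : V → Option E}
    (hf : (X.incMat.submatrix id f).det ≠ 0) : X.ConnectedBy {e | some e ∈ Set.range f} := by
  classical
  by_contra hcon
  apply hf
  have : ∃ v w : V, ¬ ∃ l : List X.Dart, (∀ a ∈ l, a.1 ∈ {e | some e ∈ Set.range f}) ∧
      X.IsWalk v l w := by
    simpa only [ConnectedBy, ‹Nonempty V›, true_and, not_forall] using hcon
  obtain ⟨v, w, hvw⟩ := this
  let P (u : V) : Prop := ∃ l : List X.Dart, (∀ a ∈ l, a.1 ∈ {e | some e ∈ Set.range f}) ∧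
      X.IsWalk v l u
  have hstep (a : X.Dart) (ha : some a.1 ∈ Set.range f) (h : P (X.init a)) : P (X.term a) := by
    obtain ⟨l, hl, hw⟩ := h
    refine ⟨l ++ [a], fun b hb => ?_, hw.append X ⟨rfl, rfl⟩⟩
    rcases List.mem_append.1 hb with hb | hb
    · exact hl b hb
    · rwa [List.mem_singleton.1 hb]
  let c (u : V) : ℤ := if P u then 1 else 0
  -- The indicator of the component of v, centred so as to be orthogonal also to the column of ones:
  -- a nonzero vector in the left kernel.
  let g (u : V) : ℤ := Fintype.card V * c u - ∑ u, c u
  refine Matrix.exists_vecMul_eq_zero_iff.1 ⟨g, fun hg => ?_, ?_⟩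
  · have hv : g v - g w = 0 := by simp [hg]
    have h1 : c v = 1 := if_pos ⟨[], by simp, rfl⟩
    have h2 : c w = 0 := if_neg hvw
    simp [g, h1, h2] at hv
  · ext j
    have hsum : Matrix.vecMul g (X.incMat.submatrix id f) j = ∑ v, g v * X.incMat v (f j) := rfl
    rw [hsum]
    cases hj : f j with
    | none => simp [incMat, g, Finset.sum_sub_distrib, ← Finset.mul_sum]
    | some e =>
      rw [vecMul_incMat_some, Pi.zero_apply, sub_eq_zero]
      have : P (X.src e) ↔ P (X.tgt e) :=
        ⟨hstep (e, true) ⟨j, hj⟩, hstep (e, false) ⟨j, hj⟩⟩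
      simp only [g, c, this]

omit [Fintype E] in
theorem exists_eq_none_of_det_incMat_ne_zero [Nonempty V] {f : V → Option E}
    (hf : (X.incMat.submatrix id f).det ≠ 0) : ∃ i, f i = none := by
  by_contra! hcon
  refine hf (Matrix.exists_vecMul_eq_zero_iff.1 ⟨1, one_ne_zero, ?_⟩)
  ext j
  have hsum : Matrix.vecMul 1 (X.incMat.submatrix id f) j =
    ∑ v, (1 : V → ℤ) v * X.incMat v (f j) := rfl
  rw [hsum]
  cases hj : f j with
  | none => exact absurd hj (hcon j)
  | some e => rw [vecMul_incMat_some]; simp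

omit [Fintype E] in
theorem injective_of_det_incMat_ne_zero {f : V → Option E}
    (hf : (X.incMat.submatrix id f).det ≠ 0) : Function.Injective f := by
  intro i j hij
  by_contra hne
  exact hf (Matrix.det_zero_of_column_eq hne fun v => by simp [hij])

open Classical in
-- A minor is nonzero only if its columns are distinct and consist of the ones column and a spanning
-- tree. The tree is determined by the range of f, so at most one summand is nonzero.
theorem det_incMat_sq [Nonempty V] (f : V → Option E) :
    (X.incMat.submatrix id f).det ^ 2 = ∑ T : {T : Set E // X.IsSpanningTree T},
      if Function.Injective f ∧ Set.range f = insert none (some '' T.1)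
      then (Fintype.card V : ℤ) ^ 2 else 0 := by
  have hT (T : Set E) (h : Set.range f = insert none (some '' T)) :
      T = {e | some e ∈ Set.range f} := by
    ext e
    simp [h]
  by_cases hdet : (X.incMat.submatrix id f).det = 0
  · rw [hdet, zero_pow two_ne_zero]
    refine (Finset.sum_eq_zero fun T _ => if_neg ?_).symm
    rintro ⟨-, h⟩
    obtain ⟨i, hi⟩ : none ∈ Set.range f := h ▸ Set.mem_insert _ _
    have := natAbs_det_incMat hi (hT _ h ▸ T.2.1)
    rw [hdet, Int.natAbs_zero] at this
    exact Fintype.card_ne_zero this.symm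
  · obtain ⟨i, hi⟩ := exists_eq_none_of_det_incMat_ne_zero hdet
    have hinj := injective_of_det_incMat_ne_zero hdet
    have hconn := connectedBy_of_det_incMat_ne_zero hdet
    have hr : Set.range f = insert none (some '' {e | some e ∈ Set.range f}) := by
      ext o
      cases o with
      | none => simpa using ⟨i, hi⟩
      | some e => simp
    have htree : X.IsSpanningTree {e | some e ∈ Set.range f} := by
      refine isSpanningTree_iff.2 ⟨hconn, ?_⟩
      have h1 : (Set.range f).ncard = Nat.card V := by
        rw [← Set.image_univ, Set.ncard_image_of_injective _ hinj, Set.ncard_univ]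
      rw [← h1, ← Set.ncard_image_of_injective _ (Option.some_injective E),
        ← Set.ncard_insert_of_notMem (a := none) (by simp) (Set.toFinite _), ← hr]
    rw [Finset.sum_eq_single ⟨_, htree⟩ (fun T _ hne => if_neg fun h => hne
      (Subtype.ext (hT _ h.2))) (by simp), if_pos ⟨hinj, hr⟩, ← natAbs_det_incMat hi hconn,
      Int.natAbs_sq]

variable (X)

/-- The matrix-tree theorem. -/
theorem det_lapMat_add_one [Nonempty V] :
    (X.lapMat (1 : X.Dart → ℤ) + Matrix.of fun _ _ => 1).det =
      (Fintype.card V : ℤ) ^ 2 * X.kappa := by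
  classical
  have h := Matrix.factorial_mul_det_mul X.incMat X.incMat.transpose
  have hsq (f : V → Option E) : (X.incMat.submatrix id f).det *
      (X.incMat.transpose.submatrix f id).det = (X.incMat.submatrix id f).det ^ 2 := by
    rw [← Matrix.transpose_submatrix, Matrix.det_transpose, sq]
  -- Each tree arises from |V|! enumerations of its columns, which cancels the factorial in
  -- `Matrix.factorial_mul_det_mul`.
  have hcount (T : {T : Set E // X.IsSpanningTree T}) :
      (∑ f : V → Option E, if Function.Injective f ∧ Set.range f = insert none (some '' T.1)
        then (Fintype.card V : ℤ) ^ 2 else 0) =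
        (Fintype.card V).factorial * (Fintype.card V : ℤ) ^ 2 := by
    rw [← Finset.sum_filter, Finset.sum_const, nsmul_eq_mul, ← Fintype.card_subtype,
      ← Nat.card_eq_fintype_card, Nat.card_injective_range_eq _ _ (Set.toFinite _),
      Nat.card_eq_fintype_card]
    rw [Set.ncard_insert_of_notMem (by simp) (Set.toFinite _),
      Set.ncard_image_of_injective _ (Option.some_injective E), (isSpanningTree_iff.1 T.2).2]
  simp only [hsq, det_incMat_sq] at h
  rw [Finset.sum_comm, Finset.sum_congr rfl fun T _ => hcount T, Finset.sum_const,
    incMat_mul_transpose, nsmul_eq_mul, Finset.card_univ,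
    ← Nat.card_eq_fintype_card (α := {T : Set E // X.IsSpanningTree T})] at h
  have hne : ((Fintype.card V).factorial : ℤ) ≠ 0 := by
    exact_mod_cast Nat.factorial_ne_zero _
  refine mul_left_cancel₀ hne (h.trans ?_)
  rw [kappa]
  ring

variable {X}

omit [DecidableEq V] in
/-- The Jacobian has as many elements as there are spanning trees. -/
theorem natCard_jac (hX : X.Connected) : Nat.card X.Jac = X.kappa := by
  classical
  have := hX.1
  have h := X.natAbs_det_lapMat_add_one hX
  rw [det_lapMat_add_one, Int.natAbs_mul, Int.natAbs_pow, Int.natAbs_natCast,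
    Int.natAbs_natCast] at h
  exact (Nat.eq_of_mul_eq_mul_left (pow_pos Fintype.card_pos 2) h).symm

omit [Fintype V] [Fintype E] [DecidableEq V] in
theorem kappa_pos [Finite V] [Finite E] (hX : X.Connected) : 0 < X.kappa := by
  obtain ⟨T, -, hT, hcard⟩ := ConnectedBy.exists_subset_ncard hX
  have : Nonempty {T : Set E // X.IsSpanningTree T} := ⟨T, isSpanningTree_iff.2 ⟨hT, hcard⟩⟩
  exact Nat.card_pos

end MatrixTree

end Multigraph

namespace Multigraph

variable {V E W F : Type*}

namespace Cover

variable {Y : Multigraph W F} {X : Multigraph V E} (π : Cover Y X)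

/-! ### Covers and their automorphisms -/

section Deck

theorem term_dart (a : Y.Dart) : X.term (π.dart a) = π.vert (Y.term a) := by
  rw [← init_inv, ← π.dart_inv, π.init_dart, init_inv]

theorem deck_init (g : π.Deck) (a : Y.Dart) : Y.init (g.1.2 a) = g.1.1 (Y.init a) := g.2.1 a

theorem deck_inv (g : π.Deck) (a : Y.Dart) : g.1.2 (Y.inv a) = Y.inv (g.1.2 a) := g.2.2.1 a

theorem deck_term (g : π.Deck) (a : Y.Dart) : Y.term (g.1.2 a) = g.1.1 (Y.term a) := by
  rw [← init_inv, ← deck_inv, deck_init, init_inv]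

theorem vert_deck (g : π.Deck) (w : W) : π.vert (g.1.1 w) = π.vert w := g.2.2.2.1 w

theorem dart_deck (g : π.Deck) (a : Y.Dart) : π.dart (g.1.2 a) = π.dart a := g.2.2.2.2 a

theorem deck_mul_apply (g h : π.Deck) (w : W) : (g * h).1.1 w = g.1.1 (h.1.1 w) := rfl

theorem eq_of_init_eq_of_dart_eq {a b : Y.Dart} (h : Y.init a = Y.init b)
    (h' : π.dart a = π.dart b) : a = b :=
  (π.bijOn_star (Y.init b)).injOn h rfl h'

theorem exists_lift_dart {w : W} {b : X.Dart} (h : X.init b = π.vert w) :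
    ∃ a, Y.init a = w ∧ π.dart a = b := by
  obtain ⟨a, ha, hab⟩ := (π.bijOn_star w).surjOn h
  exact ⟨a, ha, hab⟩

variable {π}

/-- An automorphism of a connected cover which fixes a vertex is the identity. -/
theorem deck_eq_one_of_apply_eq (hY : Y.Connected) {g : π.Deck} {w : W} (h : g.1.1 w = w) :
    g = 1 := by
  have hdart {a : Y.Dart} (ha : g.1.1 (Y.init a) = Y.init a) : g.1.2 a = a :=
    π.eq_of_init_eq_of_dart_eq (by rw [deck_init, ha]) (π.dart_deck g a)
  have hvert : ∀ u, g.1.1 u = u := hY.induction (P := fun u => g.1.1 u = u)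
    (fun a _ ha => by rw [← deck_term, hdart ha]) h
  exact Subtype.ext (Prod.ext (Equiv.ext hvert) (Equiv.ext fun a => hdart (hvert _)))

theorem deck_apply_injective (hY : Y.Connected) (w : W) :
    Function.Injective fun g : π.Deck => g.1.1 w := by
  intro g h hgh
  have hgh : g.1.1 w = h.1.1 w := hgh
  have : (h⁻¹ * g).1.1 w = w := by
    rw [deck_mul_apply, hgh, ← deck_mul_apply, inv_mul_cancel]
    rfl
  exact (inv_mul_eq_one.1 (deck_eq_one_of_apply_eq hY this)).symm

/-- The automorphism group of a connected Galois cover acts simply transitively on the fibers. -/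
noncomputable def deckEquivFiber (hY : Y.Connected) (hGal : π.IsGalois) (w : W) :
    π.Deck ≃ {w' : W // π.vert w' = π.vert w} :=
  Equiv.ofBijective (fun g => ⟨g.1.1 w, π.vert_deck g w⟩)
    ⟨fun g h hgh => deck_apply_injective hY w (congrArg Subtype.val hgh), fun w' => by
      obtain ⟨g, hg⟩ := hGal w w'.1 w'.2.symm
      exact ⟨g, Subtype.ext hg⟩⟩

/-- All fibres have the same number of elements, and the fibre under some vertex of Y is nonempty.
-/
theorem surjective_vert (hY : Y.Connected) {d : ℕ}
    (hd : ∀ v, Nat.card {w : W // π.vert w = v} = d) [Finite W] : Function.Surjective π.vert := by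
  intro v
  obtain ⟨w⟩ := hY.1
  have : Nonempty {w' : W // π.vert w' = π.vert w} := ⟨w, rfl⟩
  have h : 0 < Nat.card {w : W // π.vert w = v} := by
    rw [hd, ← hd (π.vert w)]
    exact Nat.card_pos
  obtain ⟨⟨w', hw'⟩⟩ := (Nat.card_pos_iff.1 h).1
  exact ⟨w', hw'⟩

theorem natCard_deck (hY : Y.Connected) (hGal : π.IsGalois) {d : ℕ}
    (hd : ∀ v, Nat.card {w : W // π.vert w = v} = d) : Nat.card π.Deck = d := by
  obtain ⟨w⟩ := hY.1
  rw [Nat.card_congr (deckEquivFiber hY hGal w), hd]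

theorem sum_deck [Fintype W] [Finite F] [DecidableEq V] (hY : Y.Connected) (hGal : π.IsGalois)
    {R : Type*} [AddCommMonoid R] (f : W → R) (w : W) :
    ∑ g : π.Deck, f (g.1.1 w) = ∑ w', if π.vert w' = π.vert w then f w' else 0 := by
  rw [← Finset.sum_filter, Finset.sum_subtype (p := fun w' => π.vert w' = π.vert w) _ (by simp)]
  exact Fintype.sum_equiv (deckEquivFiber hY hGal w) _ _ fun g => rfl

end Deck

/-! ### The Jacobian of a Galois cover -/

section Jacobian

variable [Fintype V] [Fintype W] [Fintype E] [Fintype F]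

omit [Fintype V] [Fintype W] in
-- The local isomorphism property in the form in which it is used: local sums of functions pulled
-- back from X can be computed on X.
theorem sum_star [DecidableEq V] [DecidableEq W] {R : Type*} [AddCommMonoid R] (f : X.Dart → R)
    (w : W) : (∑ a, if Y.init a = w then f (π.dart a) else 0) =
      ∑ b, if X.init b = π.vert w then f b else 0 := by
  rw [← Finset.sum_filter, ← Finset.sum_filter]
  refine Finset.sum_bij (fun a _ => π.dart a) ?_ ?_ ?_ (fun _ _ => rfl)
  · intro a ha
    simp only [Finset.mem_filter, Finset.mem_univ, true_and] at ha ⊢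
    rw [π.init_dart, ha]
  · intro a ha b hb hab
    simp only [Finset.mem_filter, Finset.mem_univ, true_and] at ha hb
    exact π.eq_of_init_eq_of_dart_eq (ha.trans hb.symm) hab
  · intro b hb
    simp only [Finset.mem_filter, Finset.mem_univ, true_and] at hb
    obtain ⟨a, ha, hab⟩ := π.exists_lift_dart hb
    exact ⟨a, by simpa using ha, hab⟩

omit [Fintype E] [Fintype F] in
theorem divMap_comp_vert [Finite E] [Finite F] (f : V → ℤ) (w : W) :
    Y.divMap (f ∘ π.vert) w = X.divMap f (π.vert w) := by
  classical
  have := Fintype.ofFinite E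
  have := Fintype.ofFinite F
  rw [divMap_apply', divMap_apply', ← sum_star]
  exact Finset.sum_congr rfl fun a _ => by rw [π.term_dart]; rfl

/-- The pullback of divisors along a cover. -/
noncomputable def pullDiv : X.Div →ₗ[ℤ] Y.Div :=
  (Finsupp.linearEquivFunOnFinite ℤ ℤ W).symm.toLinearMap ∘ₗ LinearMap.funLeft ℤ ℤ π.vert ∘ₗ
    (Finsupp.linearEquivFunOnFinite ℤ ℤ V).toLinearMap

omit [Fintype E] [Fintype F] in
@[simp] theorem pullDiv_apply (D : X.Div) (w : W) :
    π.pullDiv D w = D (π.vert w) := rfl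

variable {π}

omit [Fintype E] [Fintype F] in
theorem deg_pullDiv {d : ℕ} (hd : ∀ v, Nat.card {w : W // π.vert w = v} = d)
    (D : X.Div) : Y.deg (π.pullDiv D) = d * X.deg D := by
  classical
  rw [deg_eq_sum, deg_eq_sum, Finset.mul_sum, ← Finset.sum_fiberwise _ π.vert]
  refine Finset.sum_congr rfl fun v _ => ?_
  rw [Finset.sum_congr rfl (g := fun _ => D v), Finset.sum_const, nsmul_eq_mul,
    ← Fintype.card_subtype, ← Nat.card_eq_fintype_card, hd]
  intro w hw
  rw [pullDiv_apply, (Finset.mem_filter.1 hw).2]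

omit [Fintype E] [Fintype F] in
/-- The norm of a divisor is the pullback of its pushforward. -/
theorem sum_actDiv [Finite F] (hY : Y.Connected) (hGal : π.IsGalois) (D : Y.Div) :
    ∑ g : π.Deck, π.actDiv g D = π.pullDiv (D.mapDomain π.vert) := by
  classical
  induction D using Finsupp.induction_linear with
  | zero => simp
  | add D D' h h' => simp only [map_add, Finset.sum_add_distrib, h, h', Finsupp.mapDomain_add]
  | single w n =>
    ext w'
    simp only [actDiv, Finsupp.lmapDomain_apply, Finsupp.mapDomain_single, pullDiv_apply,
      Finsupp.finsetSum_apply]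
    rw [sum_deck hY hGal (fun u => Finsupp.single u n w') w, Finset.sum_eq_single w']
    · rw [Finsupp.single_eq_same, Finsupp.single_apply]
      simp only [eq_comm]
    · intro u _ hu
      rw [Finsupp.single_eq_of_ne' hu, ite_self]
    · simp

omit [Fintype E] [Fintype F] in
theorem pullDiv_divMap [Finite E] [Finite F] (f : V → ℤ) :
    π.pullDiv (X.divMap f) = Y.divMap (f ∘ π.vert) := by
  ext w
  rw [pullDiv_apply, divMap_comp_vert]

omit [Fintype E] [Fintype F] in
/-- A divisor of `X` is principal if its pullback is. -/
theorem mem_pr_of_pullDiv_mem [Finite E] [Finite F] (hY : Y.Connected) (hGal : π.IsGalois)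
    (hsurj : Function.Surjective π.vert) {D : X.Div} (h : π.pullDiv D ∈ Y.Pr) : D ∈ X.Pr := by
  obtain ⟨f, hf⟩ := h
  -- The pulled-back divisor is G-invariant, so f ∘ g⁻¹ − f has trivial divisor and is constant. Its
  -- values sum to 0, so the constant is 0 and f descends to X.
  have hinv (g : π.Deck) (w : W) : f (g.1.1.symm w) = f w := by
    have h1 : Y.divMap (f ∘ g.1.1.symm - f) = 0 := by
      rw [map_sub, ← actDiv_divMap, hf, sub_eq_zero]
      ext w
      have h2 : π.actDiv g (π.pullDiv D) (g.1.1 (g.1.1.symm w)) = π.pullDiv D (g.1.1.symm w) :=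
        Finsupp.mapDomain_apply g.1.1.injective _ _
      rw [Equiv.apply_symm_apply] at h2
      rw [h2, pullDiv_apply, pullDiv_apply, ← π.vert_deck g, Equiv.apply_symm_apply]
    obtain ⟨k, hk⟩ := (Y.divMap_eq_zero_iff hY _).1 h1
    have h3 : ∑ w, (f (g.1.1.symm w) - f w) = 0 := by
      rw [Finset.sum_sub_distrib, Equiv.sum_comp g.1.1.symm f, sub_self]
    have h4 (w) : f (g.1.1.symm w) - f w = k := hk w
    simp only [h4, Finset.sum_const, smul_eq_zero, Finset.card_univ] at h3
    have := hY.1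
    have h5 := h4 w
    rw [h3.resolve_left Fintype.card_ne_zero] at h5
    exact sub_eq_zero.1 h5
  obtain ⟨s, hs⟩ := hsurj.hasRightInverse
  refine ⟨f ∘ s, ?_⟩
  have hfs : (f ∘ s) ∘ π.vert = f := by
    ext w
    obtain ⟨g, hg⟩ := hGal (s (π.vert w)) w (hs _)
    have := hinv g w
    rw [← hg, Equiv.symm_apply_apply] at this
    rw [hg] at this
    exact this
  ext v
  obtain ⟨w, rfl⟩ := hsurj v
  rw [← π.divMap_comp_vert, hfs, hf, pullDiv_apply]

variable (π) in
/-- The pullback on Jacobians. -/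
noncomputable def pullJac {d : ℕ} (hd : ∀ v, Nat.card {w : W // π.vert w = v} = d) :
    X.Jac →ₗ[ℤ] Y.Jac :=
  Submodule.mapQ _ _ (π.pullDiv.restrict (p := X.DivZero) (q := Y.DivZero) fun D hD => by
      rw [DivZero, LinearMap.mem_ker] at *
      rw [deg_pullDiv hd, hD, mul_zero]) <| by
    rintro ⟨D, hD⟩ ⟨f, hf⟩
    exact ⟨f ∘ π.vert, by rw [← pullDiv_divMap, hf]; rfl⟩

theorem pullJac_injective (hY : Y.Connected) (hGal : π.IsGalois) {d : ℕ}
    (hd : ∀ v, Nat.card {w : W // π.vert w = v} = d) : Function.Injective (π.pullJac hd) := by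
  rw [injective_iff_map_eq_zero]
  intro x
  obtain ⟨D, rfl⟩ := Submodule.Quotient.mk_surjective _ x
  intro h
  rw [pullJac, Submodule.mapQ_apply, Submodule.Quotient.mk_eq_zero] at h
  rw [Submodule.Quotient.mk_eq_zero]
  exact mem_pr_of_pullDiv_mem hY hGal (surjective_vert hY hd) h

/-- The norm is pullback after pushforward, and pushforward is onto in degree 0 because a section of
the vertices gives preimages. -/
theorem range_pullJac (hY : Y.Connected) (hGal : π.IsGalois) {d : ℕ}
    (hd : ∀ v, Nat.card {w : W // π.vert w = v} = d) :
    LinearMap.range (π.pullJac hd) = LinearMap.range π.normJac := by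
  have hdeg (f : W → V) (D : Y.Div) : X.deg (D.mapDomain f) = Y.deg D := by
    rw [deg, deg, Finsupp.lsum_apply, Finsupp.lsum_apply,
      Finsupp.sum_mapDomain_index (by simp) (by simp)]
  have hdeg' (f : V → W) (D : X.Div) : Y.deg (D.mapDomain f) = X.deg D := by
    rw [deg, deg, Finsupp.lsum_apply, Finsupp.lsum_apply,
      Finsupp.sum_mapDomain_index (by simp) (by simp)]
  have hmem (D : Y.DivZero) : D.1.mapDomain π.vert ∈ X.DivZero := by
    have := D.2
    rw [DivZero, LinearMap.mem_ker] at *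
    rw [hdeg, this]
  have key (D : Y.DivZero) : π.normJac (Submodule.Quotient.mk D) =
      π.pullJac hd (Submodule.Quotient.mk ⟨_, hmem D⟩) := by
    have h1 : π.normJac (Submodule.Quotient.mk D) = Submodule.Quotient.mk
        (∑ g : π.Deck, (π.actDiv g).restrict (π.actDiv_mem_divZero g) D) := by
      rw [normJac, LinearMap.sum_apply]
      exact (map_sum (Submodule.mkQ _) _ _).symm
    rw [h1, pullJac, Submodule.mapQ_apply]
    congr 1
    ext1
    rw [AddSubmonoidClass.coe_finsetSum]
    exact sum_actDiv hY hGal D.1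
  apply le_antisymm
  · rintro _ ⟨x, rfl⟩
    obtain ⟨D, rfl⟩ := Submodule.Quotient.mk_surjective _ x
    obtain ⟨s, hs⟩ := (surjective_vert hY hd).hasRightInverse
    have hD : X.deg D.1 = 0 := D.2
    refine ⟨Submodule.Quotient.mk ⟨D.1.mapDomain s, by
      rw [DivZero, LinearMap.mem_ker, hdeg', hD]⟩, ?_⟩
    rw [key]
    congr 2
    ext1
    change (D.1.mapDomain s).mapDomain π.vert = D.1
    rw [← Finsupp.mapDomain_comp, hs.comp_eq_id, Finsupp.mapDomain_id]
  · rintro _ ⟨x, rfl⟩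
    obtain ⟨D, rfl⟩ := Submodule.Quotient.mk_surjective _ x
    exact ⟨_, (key D).symm⟩

/-- Jac⁰(Y) is the kernel of the norm, whose image is isomorphic to Jac(X) by injectivity of the
pullback. -/
theorem natCard_jacZero_mul (hY : Y.Connected) (hGal : π.IsGalois) {d : ℕ}
    (hd : ∀ v, Nat.card {w : W // π.vert w = v} = d) :
    Nat.card π.JacZero * Nat.card X.Jac = Nat.card Y.Jac := by
  have h1 : Nat.card X.Jac = Nat.card (LinearMap.range π.normJac) := by
    rw [← range_pullJac hY hGal hd]
    exact Nat.card_congr (LinearEquiv.ofInjective _ (pullJac_injective hY hGal hd)).toEquiv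
  rw [h1, ← Nat.card_congr π.normJac.quotKerEquivRange.toEquiv]
  exact (Submodule.card_eq_card_quotient_mul_card (LinearMap.ker π.normJac)).symm

theorem natCard_jacZero_mul_kappa (hX : X.Connected) (hY : Y.Connected) (hGal : π.IsGalois) {d : ℕ}
    (hd : ∀ v, Nat.card {w : W // π.vert w = v} = d) :
    Nat.card π.JacZero * X.kappa = Y.kappa := by
  rw [← natCard_jac hX, ← natCard_jac hY, natCard_jacZero_mul hY hGal hd]

end Jacobian

end Cover

end Multigraph

/-! ### Characters of finite abelian groups -/

section Characters

variable {G : Type*} [CommGroup G] [Fintype G] [Fintype (G →* ℂˣ)]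

theorem nonempty_equiv_monoidHom_units (G : Type*) [CommGroup G] [Finite G] :
    Nonempty (G ≃ (G →* ℂˣ)) :=
  (CommGroup.monoidHom_mulEquiv_of_hasEnoughRootsOfUnity G ℂ).map fun e => e.toEquiv.symm

omit [Fintype (G →* ℂˣ)] in
theorem sum_char_eq_zero {χ : G →* ℂˣ} (hχ : χ ≠ 1) : ∑ g, (χ g : ℂ) = 0 := by
  refine sum_hom_units_eq_zero ((Units.coeHom ℂ).comp χ) fun h => hχ ?_
  ext g
  exact DFunLike.congr_fun h g

open Classical in
omit [Fintype (G →* ℂˣ)] in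
theorem sum_char_inv_mul (χ ψ : G →* ℂˣ) :
    ∑ g, ((χ g)⁻¹ : ℂ) * (ψ g : ℂ) = if χ = ψ then (Fintype.card G : ℂ) else 0 := by
  split_ifs with h
  · subst h
    simp
  · have := sum_char_eq_zero (χ := χ⁻¹ * ψ) fun h' => h (inv_mul_eq_one.1 h')
    simpa using this

/-- The character table, with columns indexed by the characters. -/
def charTable (G : Type*) [CommGroup G] : Matrix G (G →* ℂˣ) ℂ := Matrix.of fun g χ => (χ g : ℂ)

/-- The conjugate of the character table, with rows indexed by the characters, divided by the
order of the group. -/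
noncomputable def charTableInv (G : Type*) [CommGroup G] [Fintype G] : Matrix (G →* ℂˣ) G ℂ :=
  Matrix.of fun χ g => (Fintype.card G : ℂ)⁻¹ * (χ g : ℂ)⁻¹

omit [Fintype (G →* ℂˣ)] in
theorem charTableInv_mul [DecidableEq (G →* ℂˣ)] : charTableInv G * charTable G = 1 := by
  ext χ ψ
  simp only [Matrix.mul_apply, charTable, charTableInv, Matrix.of_apply, mul_assoc,
    ← Finset.mul_sum]
  rw [sum_char_inv_mul, Matrix.one_apply]
  split_ifs <;> simp

/-- The second orthogonality relation follows from the first: as |Ĝ| = |G| the table is square, and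
a left inverse is a right inverse. -/
theorem charTable_mul [DecidableEq G] : charTable G * charTableInv G = 1 := by
  classical
  exact (Matrix.mul_eq_one_comm_of_equiv (nonempty_equiv_monoidHom_units G).some).2
    charTableInv_mul

/-- A function on a finite abelian group is determined by its Fourier transform. -/
theorem eq_of_sum_mul_char_eq {x y : G → ℂ}
    (h : ∀ χ : G →* ℂˣ, ∑ g, x g * χ g = ∑ g, y g * χ g) : x = y := by
  classical
  have h1 : Matrix.vecMul x (charTable G) = Matrix.vecMul y (charTable G) := funext h
  have h2 := congrArg (fun z => Matrix.vecMul z (charTableInv G)) h1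
  simpa only [Matrix.vecMul_vecMul, charTable_mul, Matrix.vecMul_one] using h2

/-- The determinant of a block circulant matrix over a finite abelian group. -/
theorem Matrix.det_blockCirculant {V : Type*} [Fintype V] [DecidableEq V] [DecidableEq G]
    (K : V → V → G → ℂ) :
    (Matrix.of fun p q : V × G => K p.1 q.1 (p.2⁻¹ * q.2)).det =
      ∏ χ : G →* ℂˣ, (Matrix.of fun v w => ∑ g, (χ g : ℂ) * K v w g).det := by
  obtain ⟨e⟩ := nonempty_equiv_monoidHom_units G
  set B : Matrix (V × G) (V × G) ℂ := Matrix.of fun p q => K p.1 q.1 (p.2⁻¹ * q.2) with hB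
  let D (h : G) : Matrix V V ℂ := Matrix.of fun v w => ∑ g, (e h g : ℂ) * K v w g
  let Q : Matrix (V × G) (V × G) ℂ :=
    Matrix.kroneckerMap (· * ·) (1 : Matrix V V ℂ) ((charTable G).submatrix id e)
  let Q' : Matrix (V × G) (V × G) ℂ :=
    Matrix.kroneckerMap (· * ·) (1 : Matrix V V ℂ) ((charTableInv G).submatrix e id)
  have hQ : Q * Q' = 1 := by
    rw [← Matrix.mul_kronecker_mul, Matrix.submatrix_mul_equiv, charTable_mul, one_mul,
      Matrix.submatrix_id_id, Matrix.one_kronecker_one]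
  -- The characters, as vectors on G, block-diagonalise B; the substitution k ↦ gk extracts the
  -- eigenfactor χ(g).
  have hcomm : B * Q = Q * Matrix.blockDiagonal D := by
    ext ⟨v, g⟩ ⟨w, h⟩
    have h1 : (B * Q) (v, g) (w, h) = ∑ k, K v w (g⁻¹ * k) * (e h k : ℂ) := by
      rw [Matrix.mul_apply, Fintype.sum_prod_type, Finset.sum_eq_single w]
      · simp [B, Q, charTable]
      · intro u _ hu
        simp [B, Q, Matrix.one_apply_ne hu]
      · simp
    have h2 : (Q * Matrix.blockDiagonal D) (v, g) (w, h) = (e h g : ℂ) * D h v w := by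
      rw [Matrix.mul_apply, Fintype.sum_prod_type, Finset.sum_eq_single v]
      · simp [Q, charTable, Matrix.blockDiagonal_apply]
      · intro u _ hu
        simp [Q, Matrix.one_apply_ne hu.symm]
      · simp
    rw [h1, h2]
    simp only [D, Matrix.of_apply, Finset.mul_sum]
    rw [← Equiv.sum_comp (Equiv.mulLeft g)]
    refine Finset.sum_congr rfl fun k _ => ?_
    simp only [Equiv.coe_mulLeft, inv_mul_cancel_left, map_mul, Units.val_mul]
    ring
  have hdet : B.det = (Matrix.blockDiagonal D).det := by
    have hQ1 : Q.det ≠ 0 := by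
      have := congrArg Matrix.det hQ
      rw [Matrix.det_mul, Matrix.det_one] at this
      exact left_ne_zero_of_mul_eq_one this
    have := congrArg Matrix.det hcomm
    rw [Matrix.det_mul, Matrix.det_mul, mul_comm] at this
    exact mul_left_cancel₀ hQ1 this
  rw [hdet, Matrix.det_blockDiagonal]
  exact Fintype.prod_equiv e _ _ fun h => rfl

end Characters

/-! ### Group rings of finite abelian groups -/

section GroupRing

variable {G : Type*} [CommGroup G]

/-- The extension of a character to the group ring. -/
noncomputable def charEval (R : Type*) [CommRing R] [Algebra R ℂ] (χ : G →* ℂˣ) :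
    MonoidAlgebra R G →ₐ[R] ℂ :=
  MonoidAlgebra.lift R ℂ G ((Units.coeHom ℂ).comp χ)

@[simp] theorem charEval_single (R : Type*) [CommRing R] [Algebra R ℂ] (χ : G →* ℂˣ) (g : G)
    (r : R) : charEval R χ (MonoidAlgebra.single g r) = algebraMap R ℂ r * χ g := by
  rw [charEval, MonoidAlgebra.lift_single, Algebra.smul_def]
  rfl

theorem charEval_apply [Fintype G] (R : Type*) [CommRing R] [Algebra R ℂ] (χ : G →* ℂˣ)
    (x : MonoidAlgebra R G) : charEval R χ x = ∑ g, algebraMap R ℂ (x.coeff g) * χ g := by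
  rw [charEval, MonoidAlgebra.lift_apply, Finsupp.sum_fintype _ _ (by simp)]
  exact Finset.sum_congr rfl fun g _ => Algebra.smul_def _ _

theorem charEval_mapRingHom (χ : G →* ℂˣ) (x : MonoidAlgebra ℤ G) :
    charEval ℂ χ (MonoidAlgebra.mapRingHom G (Int.castRingHom ℂ) x) = charEval ℤ χ x := by
  induction x using MonoidAlgebra.induction_linear with
  | zero => simp
  | add x y hx hy => simp only [map_add, hx, hy]
  | single g n => simp

theorem charEval_injective [Finite G] {x y : MonoidAlgebra ℂ G}
    (h : ∀ χ : G →* ℂˣ, charEval ℂ χ x = charEval ℂ χ y) : x = y := by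
  have := Fintype.ofFinite G
  have := Finite.of_equiv _ (nonempty_equiv_monoidHom_units G).some
  have := Fintype.ofFinite (G →* ℂˣ)
  simp only [charEval_apply] at h
  exact MonoidAlgebra.ext (Finsupp.ext (congrFun (eq_of_sum_mul_char_eq h)))

theorem charEval_int_injective [Finite G] {x y : MonoidAlgebra ℤ G}
    (h : ∀ χ : G →* ℂˣ, charEval ℤ χ x = charEval ℤ χ y) : x = y := by
  have := Fintype.ofFinite G
  have := Finite.of_equiv _ (nonempty_equiv_monoidHom_units G).some
  have := Fintype.ofFinite (G →* ℂˣ)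
  simp only [charEval_apply] at h
  refine MonoidAlgebra.ext (Finsupp.ext fun g => ?_)
  have := congrFun (eq_of_sum_mul_char_eq h) g
  simpa using this

/-- The augmentation of the integral group ring. -/
noncomputable def augmentation (G : Type*) [CommGroup G] : MonoidAlgebra ℤ G →ₐ[ℤ] ℤ :=
  MonoidAlgebra.lift ℤ ℤ G 1

@[simp] theorem augmentation_single (g : G) (n : ℤ) :
    augmentation G (MonoidAlgebra.single g n) = n := by
  simp [augmentation]

theorem charEval_one_eq (x : MonoidAlgebra ℤ G) : charEval ℤ 1 x = augmentation G x := by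
  induction x using MonoidAlgebra.induction_linear with
  | zero => simp
  | add x y hx hy => rw [map_add, map_add, hx, hy, Int.cast_add]
  | single g n => simp

variable [Fintype G]

/-- The norm element of the integral group ring. -/
noncomputable def normElt (G : Type*) [CommGroup G] [Fintype G] : MonoidAlgebra ℤ G :=
  ∑ g : G, MonoidAlgebra.single g 1

theorem augmentation_normElt : augmentation G (normElt G) = Fintype.card G := by
  simp [normElt]

theorem coeff_normElt (g : G) : (normElt G).coeff g = 1 := by
  classical
  simp [normElt, Finsupp.single_apply]

theorem charEval_normElt {χ : G →* ℂˣ} (hχ : χ ≠ 1) : charEval ℤ χ (normElt G) = 0 := by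
  simp [normElt, sum_char_eq_zero hχ]

/-- The determinant of multiplication by an element of the group ring. -/
theorem det_mulLeft_eq_prod_charEval [Fintype (G →* ℂˣ)] (x : MonoidAlgebra ℤ G) :
    ((LinearMap.mulLeft ℤ x).det : ℂ) = ∏ χ : G →* ℂˣ, charEval ℤ χ x := by
  classical
  -- Multiplication by x has entry x(gh⁻¹) at (g, h), hence the inverse on k. It is undone below by
  -- χ ↦ χ⁻¹, which permutes the factors.
  have h := Matrix.det_blockCirculant (V := Unit) (G := G) fun _ _ k => ((x.coeff k⁻¹ : ℤ) : ℂ)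
  rw [← LinearMap.det_toMatrix (MonoidAlgebra.basis G ℤ)]
  refine (RingHom.map_det (Int.castRingHom ℂ) _).trans ?_
  have hM : (Matrix.of fun p q : Unit × G => ((x.coeff (p.2⁻¹ * q.2)⁻¹ : ℤ) : ℂ)) =
      Matrix.reindex (Equiv.punitProd G).symm (Equiv.punitProd G).symm
        ((Int.castRingHom ℂ).mapMatrix (LinearMap.toMatrix (MonoidAlgebra.basis G ℤ)
          (MonoidAlgebra.basis G ℤ) (LinearMap.mulLeft ℤ x))) := by
    ext ⟨_, g⟩ ⟨_, h⟩
    have : LinearMap.toMatrix (MonoidAlgebra.basis G ℤ) (MonoidAlgebra.basis G ℤ)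
        (LinearMap.mulLeft ℤ x) g h = x.coeff (g⁻¹ * h)⁻¹ := by
      rw [LinearMap.toMatrix_apply, MonoidAlgebra.basis_apply, LinearMap.mulLeft_apply]
      change (x * MonoidAlgebra.single h 1).coeff g = _
      simp [mul_comm]
    exact congrArg (Int.cast : ℤ → ℂ) this.symm
  rw [hM, Matrix.det_reindex_self] at h
  rw [h, ← Equiv.prod_comp (Equiv.inv (G →* ℂˣ))]
  refine Finset.prod_congr rfl fun χ _ => ?_
  rw [Matrix.det_unique, Matrix.of_apply, charEval_apply, ← Equiv.sum_comp (Equiv.inv G)]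
  exact Finset.sum_congr rfl fun g _ => by simp [mul_comm]

open Classical in
/-- If `t` is an element of the augmentation ideal `I` on which no nontrivial character vanishes,
then `|G| · |I / (t)|` is the product of its nontrivial character values, up to sign. -/
theorem relIndex_span_mul_card [Fintype (G →* ℂˣ)] (t : MonoidAlgebra ℤ G)
    (ht : augmentation G t = 0) (hχ : ∀ χ : G →* ℂˣ, χ ≠ 1 → charEval ℤ χ t ≠ 0) :
    ((Ideal.span {t}).toAddSubgroup.relIndex
        (RingHom.ker (augmentation G)).toAddSubgroup : ℝ) * Fintype.card G =
      ‖∏ χ ∈ Finset.univ.erase (1 : G →* ℂˣ), charEval ℤ χ t‖ := by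
  have hε (x : MonoidAlgebra ℤ G) : x * normElt G = augmentation G x • normElt G := by
    refine charEval_int_injective fun χ => ?_
    by_cases h : χ = 1
    · subst h
      simp [charEval_one_eq]
    · simp [charEval_normElt h]
  have hcard : (Fintype.card G : ℂ) ≠ 0 := by exact_mod_cast Fintype.card_ne_zero
  have h := LinearMap.natAbs_det_add_smul (LinearMap.mulLeft ℤ t) (augmentation G).toLinearMap
    (fun k => ⟨MonoidAlgebra.single 1 k, by simp⟩) (normElt G) (fun x => by simp [ht]) (fun x => by
      constructor
      · intro hx
        refine ⟨x.coeff 1, MonoidAlgebra.ext (Finsupp.ext fun g => ?_)⟩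
        -- If tx = 0, every nontrivial character kills x, so translation by g⁻¹ does not change its
        -- character values. Hence x has constant coefficients.
        have h1 : MonoidAlgebra.single g⁻¹ 1 * x = x := by
          refine charEval_int_injective fun χ => ?_
          by_cases h : χ = 1
          · subst h
            simp
          · have := congrArg (charEval ℤ χ) hx
            rw [LinearMap.mulLeft_apply, map_mul, map_zero] at this
            rw [map_mul, (mul_eq_zero.1 this).resolve_left (hχ χ h), mul_zero]
        have h2 : x.coeff g = x.coeff 1 := by
          conv_rhs => rw [← h1]
          simp
        rw [h2, MonoidAlgebra.coeff_smul_apply, coeff_normElt, smul_eq_mul, mul_one]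
      · rintro ⟨k, rfl⟩
        rw [LinearMap.mulLeft_apply, mul_smul_comm, hε, ht, zero_smul, smul_zero])
    (by simp [augmentation_normElt])
  -- The correction term is multiplication by the norm element N. The characters of t + N are |G| at
  -- χ = 1 and χ(t) elsewhere, so the determinant is |G| ∏_{χ≠1} χ(t).
  have hψ : LinearMap.mulLeft ℤ t + (augmentation G).toLinearMap.smulRight (normElt G) =
      LinearMap.mulLeft ℤ (t + normElt G) := by
    refine LinearMap.ext fun x => ?_
    simp only [LinearMap.add_apply, LinearMap.mulLeft_apply, LinearMap.smulRight_apply, add_mul]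
    rw [mul_comm (normElt G), hε]
    rfl
  have hr : (LinearMap.mulLeft ℤ t).toAddMonoidHom.range =
      (Ideal.span {t}).toAddSubgroup := by
    ext x
    rw [Submodule.mem_toAddSubgroup, Ideal.mem_span_singleton']
    exact exists_congr fun a => by rw [mul_comm]; rfl
  rw [hψ, hr] at h
  have hν : (augmentation G).toLinearMap (normElt G) = Fintype.card G := augmentation_normElt
  rw [hν, Int.natAbs_natCast] at h
  have hk : (augmentation G).toLinearMap.toAddMonoidHom.ker =
      (RingHom.ker (augmentation G)).toAddSubgroup := rfl
  rw [hk] at h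
  have h3 := det_mulLeft_eq_prod_charEval (t + normElt G)
  rw [← Finset.mul_prod_erase _ _ (Finset.mem_univ 1), charEval_one_eq, map_add, ht,
    augmentation_normElt, zero_add, Finset.prod_congr rfl (g := fun χ => charEval ℤ χ t)] at h3
  · have h4 := congrArg norm h3
    rw [norm_mul, Complex.norm_intCast, ← Int.cast_abs, Int.abs_eq_natAbs, h] at h4
    have hcard' : (Fintype.card G : ℝ) ≠ 0 := by exact_mod_cast Fintype.card_ne_zero
    refine mul_left_cancel₀ hcard' ?_
    rw [Int.cast_natCast, Int.cast_natCast, Complex.norm_natCast] at h4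
    push_cast at h4
    rw [← h4]
    ring
  · intro χ hχ
    rw [map_add, charEval_normElt (Finset.ne_of_mem_erase hχ), add_zero]

end GroupRing

namespace Multigraph

variable {V E W F : Type*}

/-! ### Bass's determinant formula -/

section Bass

variable [Fintype V] [Fintype E] [DecidableEq V] [DecidableEq E] (X : Multigraph V E)
  {R : Type*} [CommRing R]

/-- The edge matrix: the entry at `(a, b)` is the weight of `a` if `b` can follow `a` in a walk
without backtrack. -/
def edgeMat (c : X.Dart → R) : Matrix X.Dart X.Dart R :=
  Matrix.of fun a b => if X.term a = X.init b ∧ b ≠ X.inv a then c a else 0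

/-- The weighted matrix of the reversal of orientation. -/
def invMat (c : X.Dart → R) : Matrix X.Dart X.Dart R :=
  Matrix.of fun a b => if b = X.inv a then c a else 0

/-- The weighted incidence matrix of oriented edges and their terminal vertices. -/
def termMat (c : X.Dart → R) : Matrix X.Dart V R :=
  Matrix.of fun a v => if X.term a = v then c a else 0

/-- The incidence matrix of oriented edges and their initial vertices. -/
def initMat (R : Type*) [CommRing R] : Matrix V X.Dart R :=
  Matrix.of fun v a => if X.init a = v then 1 else 0

omit [Fintype E] in
-- All continuations of an oriented edge, separated into those without backtrack and the backtrack
-- itself.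
theorem termMat_mul_initMat (c : X.Dart → R) :
    X.termMat c * X.initMat R = X.edgeMat c + X.invMat c := by
  ext a b
  rw [Matrix.mul_apply, Finset.sum_eq_single (X.term a)]
  · simp only [termMat, initMat, edgeMat, invMat, Matrix.of_apply, Matrix.add_apply, if_true]
    by_cases h : b = X.inv a
    · subst h
      simp
    · simp only [h, not_false_eq_true, and_true, if_false, add_zero, mul_ite, mul_one, mul_zero,
        ne_eq, eq_comm]
  · intro v _ hv
    simp [termMat, hv.symm]
  · simp

omit [Fintype V] [DecidableEq E] in
theorem initMat_mul_termMat (c : X.Dart → R) : X.initMat R * X.termMat c = X.adjMat c := by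
  ext v w
  rw [Matrix.mul_apply, adjMat]
  exact Finset.sum_congr rfl fun a _ => by
    simp only [initMat, termMat, Matrix.of_apply, ite_and, ite_mul, one_mul, zero_mul]

omit [Fintype V] [DecidableEq V] in
theorem invMat_mul_apply {n : Type*} (c : X.Dart → R) (N : Matrix X.Dart n R) (a : X.Dart)
    (j : n) : (X.invMat c * N) a j = c a * N (X.inv a) j := by
  rw [Matrix.mul_apply, Finset.sum_eq_single (X.inv a)]
  · simp [invMat]
  · intro b _ hb
    simp [invMat, hb]
  · simp

omit [Fintype V] [DecidableEq V] in
theorem invMat_mul_self {c : X.Dart → R} (hc : ∀ a, c a * c (X.inv a) = 1) :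
    X.invMat c * X.invMat c = 1 := by
  ext a b
  rw [invMat_mul_apply, Matrix.one_apply]
  simp only [invMat, Matrix.of_apply, inv_inv, mul_ite, hc, mul_zero, eq_comm]

omit [Fintype V] in
-- Going along an edge and back returns to the same vertex with weight 1, so only the degree is
-- left.
theorem initMat_mul_invMat_mul_termMat {c : X.Dart → R} (hc : ∀ a, c a * c (X.inv a) = 1) :
    X.initMat R * (X.invMat c * X.termMat c) = X.degMat R := by
  ext v w
  rw [Matrix.mul_apply, degMat, Matrix.diagonal_apply]
  simp only [invMat_mul_apply, initMat, termMat, Matrix.of_apply, term_inv, mul_ite, hc, mul_zero,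
    ite_mul, one_mul, zero_mul]
  split_ifs with h
  · subst h
    rw [degree_eq_sum]
    exact Finset.sum_congr rfl fun a _ => by split_ifs <;> rfl
  · refine Finset.sum_eq_zero fun a _ => ?_
    split_ifs with h1 h2
    · exact absurd (h2.symm.trans h1) h
    · rfl
    · rfl

omit [Fintype V] [DecidableEq V] in
-- Grouping the two orientations of each edge gives 2 × 2 diagonal blocks of determinant 1 − u².
theorem det_one_sub_smul_invMat {c : X.Dart → R} (hc : ∀ a, c a * c (X.inv a) = 1) (u : R) :
    (1 - u • X.invMat c).det = (1 - u ^ 2) ^ Fintype.card E := by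
  have h : Matrix.reindex (Equiv.prodComm E Bool) (Equiv.prodComm E Bool) (1 - u • X.invMat c) =
      Matrix.blockDiagonal fun e => Matrix.of fun b b' : Bool =>
        if b = b' then 1 else -(u * c (e, b)) := by
    ext ⟨b, e⟩ ⟨b', e'⟩
    rw [Matrix.blockDiagonal_apply]
    by_cases he : e = e'
    · subst he
      cases b <;> cases b' <;> simp [invMat, inv]
    · simp [invMat, inv, he, Ne.symm he]
  rw [← Matrix.det_reindex_self (Equiv.prodComm E Bool), h, Matrix.det_blockDiagonal]
  have h2 (e : E) : (Matrix.of fun b b' : Bool => if b = b' then 1 else -(u * c (e, b))).det =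
      1 - u ^ 2 := by
    rw [← Matrix.det_reindex_self finTwoEquiv.symm, Matrix.det_fin_two]
    have := hc (e, true)
    simp only [inv, Bool.not_true] at this
    simp [finTwoEquiv]
    linear_combination u ^ 2 * this
  rw [Finset.prod_congr rfl fun e _ => h2 e, Finset.prod_const, Finset.card_univ]

/-- Bass's three term determinant formula, with weights. -/
theorem bass [IsDomain R] {c : X.Dart → R} (hc : ∀ a, c a * c (X.inv a) = 1) (u : R)
    (hu : 1 - u ^ 2 ≠ 0) :
    (1 - u ^ 2) ^ Fintype.card V * (1 - u • X.edgeMat c).det =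
      (1 - u ^ 2) ^ Fintype.card E *
        ((1 - u ^ 2) • (1 : Matrix V V R) - u • X.adjMat c + u ^ 2 • X.degMat R).det := by
  set q := 1 - u ^ 2 with hq
  set T := u • ((1 - u • X.invMat c) * X.termMat c) with hT
  -- Since the weighted reversal squares to 1, this factor turns 1 − uW into q minus a product
  -- through the vertices. Interchanging that product's factors below passes from size 2|E| to size
  -- |V|.
  have h1 : (1 - u • X.invMat c) * (1 - u • X.edgeMat c) =
      q • (1 : Matrix X.Dart X.Dart R) - T * X.initMat R := by
    rw [hT, Matrix.smul_mul, Matrix.mul_assoc, termMat_mul_initMat]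
    simp only [sub_mul, mul_sub, mul_add, Matrix.smul_mul, Matrix.mul_smul, one_mul, mul_one,
      X.invMat_mul_self hc, hq, sub_smul, smul_sub, smul_add, one_smul, smul_smul, pow_two]
    abel
  have h2 : X.initMat R * T = u • X.adjMat c - u ^ 2 • X.degMat R := by
    rw [hT, Matrix.mul_smul, Matrix.sub_mul, Matrix.one_mul, Matrix.mul_sub, initMat_mul_termMat,
      Matrix.smul_mul,
      Matrix.mul_smul, X.initMat_mul_invMat_mul_termMat hc, smul_sub, smul_smul, pow_two]
  have h3 := congrArg (Polynomial.eval q) (Matrix.charpoly_mul_comm' T (X.initMat R))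
  simp only [Polynomial.eval_mul, Polynomial.eval_pow, Polynomial.eval_X,
    Matrix.eval_charpoly] at h3
  have h4 := congrArg Matrix.det h1
  rw [Matrix.det_mul, X.det_one_sub_smul_invMat hc, ← hq] at h4
  have hs : Matrix.scalar X.Dart q = q • (1 : Matrix X.Dart X.Dart R) := by
    rw [Matrix.smul_one_eq_diagonal]; rfl
  have hs' : Matrix.scalar V q = q • (1 : Matrix V V R) := by
    rw [Matrix.smul_one_eq_diagonal]; rfl
  rw [hs, hs', ← h4, h2, Fintype.card_prod, Fintype.card_bool, mul_comm _ 2, two_mul, pow_add] at h3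
  refine mul_left_cancel₀ (pow_ne_zero (Fintype.card E) hu) ?_
  rw [sub_add]
  linear_combination h3

open Polynomial in
theorem bass_charpolyRev [IsDomain R] {c : X.Dart → R} (hc : ∀ a, c a * c (X.inv a) = 1) :
    (1 - (Polynomial.X : R[X]) ^ 2) ^ Fintype.card V * (X.edgeMat c).charpolyRev =
      (1 - (Polynomial.X : R[X]) ^ 2) ^ Fintype.card E *
        ((1 - (Polynomial.X : R[X]) ^ 2) • (1 : Matrix V V R[X]) -
          (Polynomial.X : R[X]) • (X.adjMat c).map C +
          (Polynomial.X : R[X]) ^ 2 • (X.degMat R).map C).det := by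
  have hu : (1 - (Polynomial.X : R[X]) ^ 2) ≠ 0 := by
    intro h
    have := congrArg (Polynomial.eval 0) h
    simp at this
  have h := X.bass (R := R[X]) (c := fun a => C (c a)) (fun a => by rw [← C_mul, hc, C_1])
    Polynomial.X hu
  have h1 : (X.edgeMat c).map C = X.edgeMat fun a => C (c a) := by
    ext1 a b
    simp only [edgeMat, Matrix.map_apply, Matrix.of_apply]
    split_ifs <;> simp
  have h2 : (X.adjMat c).map C = X.adjMat fun a => C (c a) := by
    ext1 v w
    simp only [adjMat, Matrix.map_apply, map_sum]
    exact Finset.sum_congr rfl fun a _ => by split_ifs <;> simp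
  have h3 : (X.degMat R).map C = X.degMat R[X] := by
    rw [degMat, Matrix.diagonal_map (map_zero _), degMat]
    simp only [map_natCast]
  rw [Matrix.charpolyRev, h1, h2, h3, h]

open Polynomial in
/-- The first nonvanishing coefficient at `1` of the reverse characteristic polynomial of the edge
matrix. -/
theorem trailingCoeff_taylor_charpolyRev_edgeMat {c : X.Dart → ℂ}
    (hc : ∀ a, c a * c (X.inv a) = 1) (hdet : (X.lapMat c).det ≠ 0) :
    (-2) ^ Fintype.card V * (taylor 1 (X.edgeMat c).charpolyRev).trailingCoeff =
      (-2) ^ Fintype.card E * (X.lapMat c).det := by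
  have h := congrArg (fun p => (taylor 1 p).trailingCoeff) (X.bass_charpolyRev hc)
  -- At u = 1 + X, 1 − u² = X(−2 − X); trailing coefficients multiply over a domain.
  have hpow (n : ℕ) : (taylor 1 ((1 - (Polynomial.X : ℂ[X]) ^ 2) ^ n)).trailingCoeff =
      (-2) ^ n := by
    induction n with
    | zero => simp [trailingCoeff]
    | succ n ih =>
      rw [pow_succ (1 - (Polynomial.X : ℂ[X]) ^ 2) n, taylor_mul, trailingCoeff_mul, ih,
        pow_succ (-2 : ℂ) n]
      congr 1
      have : taylor 1 (1 - (Polynomial.X : ℂ[X]) ^ 2) = Polynomial.X * (C (-2) - Polynomial.X) := by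
        rw [map_sub, taylor_one, taylor_X_pow]
        simp only [map_one, map_neg, map_ofNat]
        ring
      rw [this, trailingCoeff_mul, trailingCoeff_eq_coeff_zero (p := C (-2) - Polynomial.X)
        (by simp)]
      simp [trailingCoeff]
  simp only [taylor_mul, trailingCoeff_mul, hpow] at h
  rw [h]
  congr 1
  set H := ((1 - (Polynomial.X : ℂ[X]) ^ 2) • (1 : Matrix V V ℂ[X]) -
          (Polynomial.X : ℂ[X]) • (X.adjMat c).map C +
          (Polynomial.X : ℂ[X]) ^ 2 • (X.degMat ℂ).map C).det with hH
  have hev : H.eval 1 = (X.lapMat c).det := by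
    rw [hH, ← coe_evalRingHom, RingHom.map_det]
    congr 1
    ext v w
    simp [lapMat, sub_eq_add_neg, add_comm]
  rw [trailingCoeff_eq_coeff_zero] <;> rw [taylor_coeff_zero, hev]
  exact hdet

end Bass

end Multigraph

/-! ### Periodic sequences -/

section Periodic

variable {α : Type*}

/-- The shift of a sequence. -/
def seqShift (x : ℕ → α) : ℕ → α := fun i => x (i + 1)

theorem seqShift_iterate (k : ℕ) (x : ℕ → α) (i : ℕ) : seqShift^[k] x i = x (i + k) := by
  induction k generalizing x with
  | zero => rfl
  | succ k ih =>
    rw [Function.iterate_succ_apply, ih, seqShift]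
    congr 1

theorem isPeriodicPt_seqShift_iff {n : ℕ} {x : ℕ → α} :
    Function.IsPeriodicPt seqShift n x ↔ ∀ i, x (i + n) = x i := by
  rw [Function.IsPeriodicPt, Function.IsFixedPt, funext_iff]
  simp only [seqShift_iterate]

theorem apply_mod_of_isPeriodicPt {n : ℕ} {x : ℕ → α} (hx : Function.IsPeriodicPt seqShift n x)
    (i : ℕ) : x (i % n) = x i :=
  Function.Periodic.map_mod_nat (isPeriodicPt_seqShift_iff.1 hx) i

theorem eq_of_isPeriodicPt {n : ℕ} (hn : 0 < n) {x y : ℕ → α}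
    (hx : Function.IsPeriodicPt seqShift n x) (hy : Function.IsPeriodicPt seqShift n y)
    (h : (List.range n).map x = (List.range n).map y) : x = y := by
  rw [List.map_inj_left] at h
  ext i
  rw [← apply_mod_of_isPeriodicPt hx, ← apply_mod_of_isPeriodicPt hy]
  exact h _ (List.mem_range.2 (Nat.mod_lt _ hn))

theorem map_range_seqShift_iterate {n : ℕ} {x : ℕ → α}
    (hx : Function.IsPeriodicPt seqShift n x) (k : ℕ) :
    (List.range n).map (seqShift^[k] x) = ((List.range n).map x).rotate k := by
  refine List.ext_getElem (by simp) fun i h1 h2 => ?_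
  rw [List.getElem_rotate]
  simp only [List.getElem_map, List.getElem_range, List.length_map, List.length_range,
    seqShift_iterate]
  rw [apply_mod_of_isPeriodicPt hx]

theorem flatten_replicate_map_range {n : ℕ} {x : ℕ → α}
    (hx : Function.IsPeriodicPt seqShift n x) (k : ℕ) :
    (List.replicate k ((List.range n).map x)).flatten = (List.range (k * n)).map x := by
  induction k with
  | zero => simp
  | succ k ih =>
    rw [List.replicate_succ, List.flatten_cons, ih, Nat.succ_mul, Nat.add_comm, List.range_add,
      List.map_append, List.map_map]
    congr 1
    refine List.map_congr_left fun i _ => ?_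
    rw [Function.comp_apply, Nat.add_comm, isPeriodicPt_seqShift_iff.1 hx]

theorem exists_periodic_extension {l : List α} (hl : l ≠ []) : ∃ x : ℕ → α,
    Function.IsPeriodicPt seqShift l.length x ∧ l = (List.range l.length).map x := by
  have hpos := List.length_pos_of_ne_nil hl
  refine ⟨fun i => l[i % l.length]'(Nat.mod_lt _ hpos), ?_, ?_⟩
  · rw [isPeriodicPt_seqShift_iff]
    intro i
    simp only [Nat.add_mod_right]
  · refine List.ext_getElem (by simp) fun i h1 h2 => ?_
    simp [Nat.mod_eq_of_lt h1]

theorem rel_of_isPeriodicPt {n : ℕ} (hn : 0 < n) {x : ℕ → α}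
    (hx : Function.IsPeriodicPt seqShift n x) {r : α → α → Prop}
    (h : ∀ i < n, r (x i) (x (i + 1))) (i : ℕ) : r (x i) (x (i + 1)) := by
  have := h (i % n) (Nat.mod_lt _ hn)
  rw [apply_mod_of_isPeriodicPt hx] at this
  rwa [← apply_mod_of_isPeriodicPt hx (i + 1), ← Nat.mod_add_mod, apply_mod_of_isPeriodicPt hx]

/-- A list is `r`-primitive if it consists of the values on a period of a periodic sequence with
consecutive terms related by `r`. -/
def IsPrimitiveList (r : α → α → Prop) (l : List α) : Prop :=
  ∃ x : ℕ → α, (∀ i, r (x i) (x (i + 1))) ∧ 0 < Function.minimalPeriod seqShift x ∧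
    l = (List.range (Function.minimalPeriod seqShift x)).map x

/-- The cycle of the values of a periodic sequence. -/
noncomputable def seqCycle (x : ℕ → α) : Cycle α :=
  ((List.range (Function.minimalPeriod seqShift x)).map x : List α)

theorem length_seqCycle (x : ℕ → α) :
    (seqCycle x).length = Function.minimalPeriod seqShift x := by
  simp [seqCycle]

theorem seqCycle_seqShift_iterate {x : ℕ → α} (hx : 0 < Function.minimalPeriod seqShift x) (k : ℕ) :
    seqCycle (seqShift^[k] x) = seqCycle x := by
  rw [seqCycle, Function.minimalPeriod_apply_iterate (Function.minimalPeriod_pos_iff_mem_periodicPts.1 hx),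
    map_range_seqShift_iterate (Function.isPeriodicPt_minimalPeriod _ _), seqCycle, Cycle.coe_eq_coe]
  exact List.IsRotated.forall _ _

/-- With `seqCycle_seqShift_iterate`, this identifies the fibres of `seqCycle` over periodic
sequences with the orbits of the shift. -/
theorem exists_iterate_of_seqCycle_eq {x y : ℕ → α} (hy : 0 < Function.minimalPeriod seqShift y)
    (h : seqCycle x = seqCycle y) :
    ∃ k < Function.minimalPeriod seqShift y, x = seqShift^[k] y := by
  have hlen : Function.minimalPeriod seqShift x = Function.minimalPeriod seqShift y := by
    rw [← length_seqCycle, h, length_seqCycle]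
  rw [seqCycle, seqCycle, Cycle.coe_eq_coe] at h
  obtain ⟨k, hk⟩ := h.symm
  rw [← map_range_seqShift_iterate (Function.isPeriodicPt_minimalPeriod _ _), hlen] at hk
  have hyp := Function.isPeriodicPt_minimalPeriod seqShift y
  refine ⟨k % _, Nat.mod_lt k hy, ?_⟩
  rw [Function.iterate_mod_minimalPeriod_eq]
  refine (eq_of_isPeriodicPt hy ?_ ?_ hk).symm
  · exact hyp.apply_iterate k
  · rw [← hlen]
    exact Function.isPeriodicPt_minimalPeriod _ _

variable [Fintype α]

/-- The sequences of period `m` with consecutive terms related by `r`. -/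
def periodicSeq (r : α → α → Prop) (m : ℕ) : Set (ℕ → α) :=
  {x | Function.IsPeriodicPt seqShift m x ∧ ∀ i, r (x i) (x (i + 1))}

theorem finite_periodicSeq (r : α → α → Prop) {m : ℕ} (hm : 0 < m) : (periodicSeq r m).Finite := by
  refine Set.Finite.of_finite_image (f := fun x (i : Fin m) => x i) (Set.toFinite _) ?_
  intro x hx y hy hxy
  refine eq_of_isPeriodicPt hm hx.1 hy.1 (List.map_congr_left fun i hi => ?_)
  exact congrFun hxy ⟨i, List.mem_range.1 hi⟩

/-! ### Traces of powers of transfer matrices -/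

section Trace

variable [DecidableEq α] (r : α → α → Prop) [DecidableRel r] {R : Type*} [CommRing R] (c : α → R)

theorem Matrix.pow_apply_eq_sum (M : Matrix α α R) (k : ℕ) (a b : α) :
    (M ^ k) a b = ∑ f : Fin (k + 1) → α, if f 0 = a ∧ f (Fin.last k) = b then
      ∏ i : Fin k, M (f i.castSucc) (f i.succ) else 0 := by
  induction k generalizing a with
  | zero =>
    rw [pow_zero, Matrix.one_apply, ← Equiv.sum_comp (Equiv.funUnique (Fin 1) α).symm]
    simp only [Equiv.funUnique_symm_apply, uniqueElim_const, Finset.univ_eq_empty,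
      Finset.prod_empty, ite_and]
    simp
  | succ k ih =>
    have hR : (∑ f : Fin (k + 2) → α, if f 0 = a ∧ f (Fin.last (k + 1)) = b then
        ∏ i : Fin (k + 1), M (f i.castSucc) (f i.succ) else 0) =
        ∑ f : Fin (k + 1) → α, if f (Fin.last k) = b then
          M a (f 0) * ∏ i : Fin k, M (f i.castSucc) (f i.succ) else 0 := by
      rw [← Equiv.sum_comp (Fin.consEquiv fun _ => α), Fintype.sum_prod_type,
        Finset.sum_eq_single a]
      · refine Finset.sum_congr rfl fun f _ => ?_
        rw [Fin.prod_univ_succ]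
        simp [Fin.consEquiv, ← Fin.succ_last]
      · intro d _ hd
        exact Finset.sum_eq_zero fun f _ => if_neg fun h => hd h.1
      · simp
    rw [hR, pow_succ', Matrix.mul_apply]
    simp only [ih, Finset.mul_sum]
    rw [Finset.sum_comm]
    refine Finset.sum_congr rfl fun f _ => ?_
    rw [Finset.sum_eq_single (f 0)]
    · simp
    · intro d _ hd
      rw [if_neg fun h => hd h.1.symm, mul_zero]
    · simp

/-- The trace of a power of a weighted transfer matrix counts periodic sequences. -/
theorem trace_pow_eq_sum_periodicSeq {m : ℕ} (hm : 0 < m) :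
    ((Matrix.of fun a b => if r a b then c a else 0) ^ m).trace =
      ∑ x ∈ (finite_periodicSeq r hm).toFinset, ∏ i ∈ Finset.range m, c (x i) := by
  have h1 : ((Matrix.of fun a b => if r a b then c a else 0) ^ m).trace =
      ∑ f : Fin (m + 1) → α, if f 0 = f (Fin.last m) ∧ ∀ i : Fin m, r (f i.castSucc) (f i.succ)
        then ∏ i : Fin m, c (f i.castSucc) else 0 := by
    simp only [Matrix.trace, Matrix.diag_apply, Matrix.pow_apply_eq_sum]
    rw [Finset.sum_comm]
    refine Finset.sum_congr rfl fun f _ => ?_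
    rw [Finset.sum_eq_single (f 0)]
    · simp only [Matrix.of_apply, Finset.prod_ite_zero, Finset.mem_univ, true_imp_iff, true_and,
        ite_and, eq_comm]
    · intro a _ ha
      exact if_neg fun h => ha h.1.symm
    · simp
  rw [h1, ← Finset.sum_filter]
  symm
  refine Finset.sum_bij (fun x _ (j : Fin (m + 1)) => x j) ?_ ?_ ?_ ?_
  · intro x hx
    obtain ⟨hx1, hx2⟩ := (Set.Finite.mem_toFinset _).1 hx
    simp only [Finset.mem_filter, Finset.mem_univ, true_and]
    refine ⟨?_, fun i => hx2 i⟩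
    have := isPeriodicPt_seqShift_iff.1 hx1 0
    rw [zero_add] at this
    exact this.symm
  · intro x hx y hy hxy
    refine eq_of_isPeriodicPt hm ((Set.Finite.mem_toFinset _).1 hx).1
      ((Set.Finite.mem_toFinset _).1 hy).1 (List.map_congr_left fun i hi => ?_)
    exact congrFun hxy (Fin.castSucc ⟨i, List.mem_range.1 hi⟩)
  · intro f hf
    obtain ⟨hf1, hf2⟩ := (Finset.mem_filter.1 hf).2
    let x : ℕ → α := fun i => f (Fin.castSucc ⟨i % m, Nat.mod_lt _ hm⟩)
    have hx : Function.IsPeriodicPt seqShift m x :=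
      isPeriodicPt_seqShift_iff.2 fun i => by simp [x]
    have hxf (j : Fin (m + 1)) : x j = f j := by
      induction j using Fin.lastCases with
      | last =>
        rw [← hf1]
        simp only [x, Fin.val_last]
        congr 1
        ext
        simp
      | cast j =>
        simp only [x, Fin.val_castSucc]
        congr 1
        ext
        simp [Nat.mod_eq_of_lt j.2]
    refine ⟨x, (Set.Finite.mem_toFinset _).2 ⟨hx, rel_of_isPeriodicPt hm hx fun i hi => ?_⟩,
      funext hxf⟩
    have := hf2 ⟨i, hi⟩
    rwa [← hxf, ← hxf] at this
  · intro x _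
    rw [Finset.prod_range]
    rfl

/-- The product of the weights of the elements of a cycle. -/
def Cycle.weight (κ : Cycle α) : R := (κ.toMultiset.map c).prod

omit [Fintype α] [DecidableEq α] in
theorem weight_coe (l : List α) : Cycle.weight c (l : Cycle α) = (l.map c).prod := by
  simp [Cycle.weight]

omit [Fintype α] [DecidableEq α] in
theorem prod_range_eq_weight_pow {x : ℕ → α} {m : ℕ}
    (h : Function.minimalPeriod seqShift x ∣ m) :
    ∏ i ∈ Finset.range m, c (x i) =
      Cycle.weight c (seqCycle x) ^ (m / Function.minimalPeriod seqShift x) := by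
  obtain ⟨k, rfl⟩ := h
  set n := Function.minimalPeriod seqShift x with hn
  have hp := isPeriodicPt_seqShift_iff.1 (Function.isPeriodicPt_minimalPeriod seqShift x)
  rw [← hn] at hp
  have hw : Cycle.weight c (seqCycle x) = ∏ i ∈ Finset.range n, c (x i) := by
    rw [seqCycle, weight_coe, List.map_map, ← hn]
    rfl
  -- A sequence that is not periodic has minimal period 0; then m = 0 and both sides are 1.
  rcases Nat.eq_zero_or_pos n with h0 | h0
  · simp [h0]
  rw [Nat.mul_div_cancel_left _ h0, hw]
  induction k with
  | zero => simp
  | succ k ih =>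
    rw [Nat.mul_succ, Nat.add_comm, Finset.prod_range_add, pow_succ', ← ih]
    congr 1
    refine Finset.prod_congr rfl fun i _ => ?_
    rw [Nat.add_comm, hp]

/-- The trace of a power of a weighted transfer matrix as a sum over primitive cycles. -/
theorem trace_pow_eq_sum_cycles {m : ℕ} (hm : 0 < m) (s : Finset (Cycle α))
    (hs : ∀ κ ∈ s, ∃ l : List α, (l : Cycle α) = κ ∧ IsPrimitiveList r l)
    (hs' : ∀ l : List α, IsPrimitiveList r l → l.length ≤ m → (l : Cycle α) ∈ s) :
    ((Matrix.of fun a b => if r a b then c a else 0) ^ m).trace =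
      ∑ κ ∈ s, if κ.length ∣ m then (κ.length : R) * κ.weight c ^ (m / κ.length) else 0 := by
  classical
  rw [trace_pow_eq_sum_periodicSeq r c hm, ← Finset.sum_fiberwise_of_maps_to (g := seqCycle) (t := s)]
  · refine Finset.sum_congr rfl fun κ hκ => ?_
    obtain ⟨l, rfl, y, hyr, hy, rfl⟩ := hs κ hκ
    change (∑ x ∈ _ with seqCycle x = seqCycle y, _) = _
    change _ = if (seqCycle y).length ∣ m then ((seqCycle y).length : R) *
      (seqCycle y).weight c ^ (m / (seqCycle y).length) else 0
    rw [length_seqCycle]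
    split_ifs with hdvd
    -- The fibre over a cycle of length n dividing m is a shift orbit with exactly n elements, each
    -- contributing the weight to the power m / n.
    · have himg : (finite_periodicSeq r hm).toFinset.filter (fun x => seqCycle x = seqCycle y) =
          (Finset.range (Function.minimalPeriod seqShift y)).image fun k => seqShift^[k] y := by
        ext x
        simp only [Finset.mem_filter, Set.Finite.mem_toFinset, Finset.mem_image, Finset.mem_range]
        constructor
        · rintro ⟨-, hxy⟩
          obtain ⟨k, hk, rfl⟩ := exists_iterate_of_seqCycle_eq hy hxy
          exact ⟨k, hk, rfl⟩
        · rintro ⟨k, -, rfl⟩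
          refine ⟨⟨?_, fun i => ?_⟩, seqCycle_seqShift_iterate hy k⟩
          · exact ((Function.isPeriodicPt_iff_minimalPeriod_dvd).2 hdvd).apply_iterate k
          · rw [seqShift_iterate, seqShift_iterate, Nat.add_right_comm]
            exact hyr _
      rw [himg, Finset.sum_image, Finset.sum_congr rfl
        (g := fun _ => (seqCycle y).weight c ^ (m / Function.minimalPeriod seqShift y)),
        Finset.sum_const, Finset.card_range, nsmul_eq_mul]
      · intro k _
        have hmin : Function.minimalPeriod seqShift (seqShift^[k] y) =
            Function.minimalPeriod seqShift y := Function.minimalPeriod_apply_iterate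
          (Function.minimalPeriod_pos_iff_mem_periodicPts.1 hy) k
        rw [prod_range_eq_weight_pow, hmin, seqCycle_seqShift_iterate hy]
        rwa [hmin]
      · intro i hi j hj hij
        exact Function.iterate_injOn_Iio_minimalPeriod (Finset.mem_range.1 hi)
          (Finset.mem_range.1 hj) hij
    · refine Finset.sum_eq_zero fun x hx => absurd ?_ hdvd
      obtain ⟨hx1, hx2⟩ := Finset.mem_filter.1 hx
      rw [← length_seqCycle, ← hx2, length_seqCycle]
      exact ((Set.Finite.mem_toFinset _).1 hx1).1.minimalPeriod_dvd
  · intro x hx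
    obtain ⟨hx1, hx2⟩ := (Set.Finite.mem_toFinset _).1 hx
    refine hs' _ ⟨x, hx2, hx1.minimalPeriod_pos hm, rfl⟩ ?_
    rw [List.length_map, List.length_range]
    exact hx1.minimalPeriod_le hm

end Trace

end Periodic

/-! ### Logarithmic derivatives of power series -/

section LogDeriv

open PowerSeries in
-- P' = PA is a recursion for the coefficients of P. The truncated form suits infinite products, as
-- only finitely many factors affect a given coefficient.
theorem PowerSeries.coeff_eq_of_derivative {P Q A B : ℂ⟦X⟧}
    (h0 : constantCoeff P = constantCoeff Q) (hP : derivative ℂ P = P * A)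
    (hQ : derivative ℂ Q = Q * B) {N : ℕ} (h : ∀ m < N, coeff m A = coeff m B) {m : ℕ}
    (hm : m ≤ N) : coeff m P = coeff m Q := by
  induction m using Nat.strong_induction_on with
  | _ m ih =>
    cases m with
    | zero => simpa using h0
    | succ m =>
      have h1 := congrArg (coeff m) hP
      have h2 := congrArg (coeff m) hQ
      rw [coeff_derivative, coeff_mul] at h1 h2
      have h3 : (m + 1 : ℂ) ≠ 0 := by exact_mod_cast Nat.succ_ne_zero m
      refine mul_right_cancel₀ h3 (h1.trans (Eq.trans ?_ h2.symm))
      refine Finset.sum_congr rfl fun ij hij => ?_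
      have := Finset.HasAntidiagonal.mem_antidiagonal.1 hij
      rw [ih ij.1 (by lia) (by lia), h ij.2 (by lia)]

open PowerSeries in
theorem PowerSeries.derivative_prod_eq_mul_sum {ι : Type*} (s : Finset ι) (P A : ι → ℂ⟦X⟧)
    (h : ∀ i ∈ s, derivative ℂ (P i) = P i * A i) :
    derivative ℂ (∏ i ∈ s, P i) = (∏ i ∈ s, P i) * ∑ i ∈ s, A i := by
  classical
  induction s using Finset.induction_on with
  | empty => simp
  | insert i s hi ih =>
    rw [Finset.prod_insert hi, Finset.sum_insert hi, Derivation.leibniz,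
      ih fun j hj => h j (Finset.mem_insert_of_mem hj), h i (Finset.mem_insert_self _ _),
      smul_eq_mul, smul_eq_mul]
    ring

open PowerSeries in
theorem PowerSeries.derivative_inv_one_sub (a : ℂ) {n : ℕ} (hn : 0 < n) :
    derivative ℂ (1 - C a * X ^ n)⁻¹ = (1 - C a * X ^ n)⁻¹ *
      mk fun m => if n ∣ m + 1 then (n : ℂ) * a ^ ((m + 1) / n) else 0 := by
  set A : ℂ⟦X⟧ := mk fun m => if n ∣ m + 1 then (n : ℂ) * a ^ ((m + 1) / n) else 0 with hA
  set f : ℂ⟦X⟧ := 1 - C a * X ^ n with hf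
  have hconst : constantCoeff f ≠ 0 := by simp [hf, hn.ne']
  have hd : derivative ℂ f = -(f * A) := by
    have hfA : f * A = A - C a * (X ^ n * A) := by
      rw [hf]
      ring
    ext m
    rw [hfA, coeff_derivative, hf, map_sub, map_neg, map_sub, coeff_C_mul,
      coeff_C_mul, coeff_X_pow_mul', coeff_X_pow, coeff_one, if_neg (Nat.succ_ne_zero m), hA,
      coeff_mk, coeff_mk]
    rcases lt_trichotomy (m + 1) n with h | h | h
    · rw [if_neg h.ne, if_neg (Nat.not_dvd_of_pos_of_lt m.succ_pos h), if_neg (by lia)]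
      simp
    · subst h
      rw [if_pos rfl, if_pos dvd_rfl, if_neg (by lia), Nat.div_self hn]
      push_cast
      ring
    · obtain ⟨k, rfl⟩ : ∃ k, m = n + k := ⟨m - n, by lia⟩
      rw [if_neg h.ne', if_pos (Nat.le_add_right n k), Nat.add_sub_cancel_left, add_assoc,
        Nat.add_div_left _ hn, pow_succ]
      simp only [Nat.dvd_add_right (dvd_refl n)]
      split_ifs <;> ring
  rw [derivative_inv', hd]
  have := PowerSeries.inv_mul_cancel f hconst
  linear_combination (f⁻¹ * A) * this

variable {n : Type*} [Fintype n] [DecidableEq n]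

open PowerSeries in
theorem Matrix.coe_charpolyRev (M : Matrix n n ℂ) :
    (M.charpolyRev : ℂ⟦X⟧) = (1 - (PowerSeries.X : ℂ⟦X⟧) • M.map PowerSeries.C).det := by
  rw [Matrix.charpolyRev]
  refine (RingHom.map_det (Polynomial.coeToPowerSeries.ringHom (R := ℂ)) _).trans ?_
  congr 1
  ext1 i j
  simp only [RingHom.mapMatrix_apply, Matrix.map_apply, Matrix.sub_apply, Matrix.smul_apply,
    map_sub, smul_eq_mul, map_mul, Matrix.one_apply, Polynomial.coeToPowerSeries.ringHom_apply,
    Polynomial.coe_X, Polynomial.coe_C]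
  split_ifs <;> simp

open PowerSeries in
/-- The logarithmic derivative of the reverse characteristic polynomial. -/
theorem Matrix.derivative_inv_charpolyRev (M : Matrix n n ℂ) :
    derivative ℂ (M.charpolyRev : ℂ⟦X⟧)⁻¹ = (M.charpolyRev : ℂ⟦X⟧)⁻¹ *
      PowerSeries.mk fun m => (M ^ (m + 1)).trace := by
  set F : ℂ⟦X⟧ := (M.charpolyRev : ℂ⟦X⟧) with hF
  have hF0 : constantCoeff F ≠ 0 := by
    rw [hF, ← coeff_zero_eq_constantCoeff_apply, Polynomial.coeff_coe,
      Polynomial.coeff_zero_eq_eval_zero, Matrix.eval_charpolyRev]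
    exact one_ne_zero
  set L : Matrix n n ℂ⟦X⟧ := M.map PowerSeries.C with hL
  set A : Matrix n n ℂ⟦X⟧ := 1 - (PowerSeries.X : ℂ⟦X⟧) • L with hA
  have hdetA : A.det = F := (Matrix.coe_charpolyRev M).symm
  have hunit : IsUnit A.det := by
    rw [hdetA]
    exact isUnit_iff_constantCoeff.2 hF0.isUnit
  have hAN : A * A⁻¹ = 1 := Matrix.mul_nonsing_inv A hunit
  set N := A⁻¹ with hN
  have hN1 : N = 1 + (PowerSeries.X : ℂ⟦X⟧) • (L * N) := by
    rw [hA, sub_mul, one_mul, Matrix.smul_mul] at hAN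
    exact sub_eq_iff_eq_add.1 hAN
  -- The geometric series for N = (1 − XL)⁻¹, unrolled one coefficient at a time through N = 1 +
  -- XLN.
  have htr (j m : ℕ) : coeff m (L ^ j * N).trace = (M ^ (j + m)).trace := by
    have hrec (j : ℕ) : (L ^ j * N).trace =
        PowerSeries.C (M ^ j).trace + PowerSeries.X * (L ^ (j + 1) * N).trace := by
      conv_lhs => rw [hN1]
      rw [mul_add, mul_one, Matrix.mul_smul, ← mul_assoc, ← pow_succ, Matrix.trace_add,
        Matrix.trace_smul, smul_eq_mul, hL]
      congr 1
      have h1 : (M.map PowerSeries.C) ^ j = (M ^ j).map (PowerSeries.C (R := ℂ)) :=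
        (map_pow (PowerSeries.C (R := ℂ)).mapMatrix M j).symm
      rw [h1]
      exact (AddMonoidHom.map_trace (PowerSeries.C (R := ℂ)) (M ^ j)).symm
    induction m generalizing j with
    | zero =>
      rw [hrec, map_add, coeff_zero_X_mul, add_zero, coeff_zero_C, add_zero]
    | succ m ih =>
      rw [hrec, map_add, coeff_succ_X_mul, ih, coeff_C, if_neg (Nat.succ_ne_zero m), zero_add,
        add_assoc, add_comm 1 m]
  have hder : derivative ℂ F = -(F * (L * N).trace) := by
    -- Jacobi's formula by a second variable ε: det(1 − (X + ε)L) = F · det(1 − εNL).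
    -- Differentiating at ε = 0 gives F' = −F tr(NL).
    have h1 : (M.charpolyRev.map (PowerSeries.C (R := ℂ))).comp
        (Polynomial.C PowerSeries.X + Polynomial.X) =
        Polynomial.C F * (1 + (Polynomial.X : Polynomial ℂ⟦X⟧) • (-(N * L)).map Polynomial.C).det := by
      have h2 : Polynomial.C F = (A.map Polynomial.C).det := by
        rw [← hdetA]
        exact RingHom.map_det Polynomial.C A
      rw [h2, ← Matrix.det_mul]
      have h3 : (M.charpolyRev.map (PowerSeries.C (R := ℂ))).comp
        (Polynomial.C PowerSeries.X + Polynomial.X) =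
        (Polynomial.compRingHom (Polynomial.C PowerSeries.X + Polynomial.X)).comp
          (Polynomial.mapRingHom (PowerSeries.C (R := ℂ))) M.charpolyRev := rfl
      rw [h3, Matrix.charpolyRev, RingHom.map_det]
      congr 1
      have h4 : A.map Polynomial.C * (N * L).map Polynomial.C = L.map Polynomial.C := by
        rw [← Matrix.map_mul, ← mul_assoc, hAN, one_mul]
      have h5 : (-(N * L)).map (Polynomial.C (R := ℂ⟦X⟧)) = -((N * L).map Polynomial.C) := by
        exact Matrix.ext fun i j => by
          rw [Matrix.map_apply, Matrix.neg_apply, Matrix.neg_apply, Matrix.map_apply, map_neg]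
      rw [mul_add, mul_one, Matrix.mul_smul, h5, mul_neg, h4]
      ext1 i j
      simp only [RingHom.mapMatrix_apply, Matrix.map_apply, Matrix.sub_apply, Matrix.smul_apply,
        Matrix.add_apply, Matrix.neg_apply, hA, hL, Matrix.one_apply, RingHom.comp_apply,
        Polynomial.coe_mapRingHom, Polynomial.coe_compRingHom, smul_eq_mul]
      split_ifs <;> simp <;> ring
    have h2 := congrArg (fun p => (Polynomial.derivative p).eval 0) h1
    simp only [Polynomial.derivative_comp, Polynomial.derivative_C_mul, Polynomial.eval_mul,
      Polynomial.eval_C, Matrix.derivative_det_one_add_X_smul, Polynomial.eval_comp] at h2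
    simp only [Polynomial.derivative_add, Polynomial.derivative_C, Polynomial.derivative_X,
      Polynomial.eval_add, Polynomial.eval_C, Polynomial.eval_X, zero_add, add_zero,
      Polynomial.eval_one, one_mul, Polynomial.derivative_map] at h2
    rw [Matrix.trace_neg, Matrix.trace_mul_comm, mul_neg] at h2
    rw [← h2, hF, derivative_coe]
    generalize Polynomial.derivative M.charpolyRev = p
    induction p using Polynomial.induction_on' with
    | add p q hp hq =>
      rw [Polynomial.coe_add, hp, hq, Polynomial.map_add, Polynomial.eval_add]
    | monomial k a =>
      rw [Polynomial.map_monomial, Polynomial.eval_monomial, ← Polynomial.C_mul_X_pow_eq_monomial]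
      simp
  have hmk : (PowerSeries.mk fun m => (M ^ (m + 1)).trace) = (L * N).trace := by
    ext m
    have := htr 1 m
    rw [pow_one, add_comm] at this
    rw [coeff_mk, this]
  rw [derivative_inv', hder, hmk]
  have := PowerSeries.inv_mul_cancel F hF0
  linear_combination (F⁻¹ * (L * N).trace) * this

end LogDeriv

namespace Multigraph

variable {V E : Type*} {X : Multigraph V E}

/-! ### The Euler product -/

section EulerProduct

theorem isWalk_map_range {x : ℕ → X.Dart} (h : ∀ i, X.term (x i) = X.init (x (i + 1))) (k : ℕ) :
    X.IsWalk (X.init (x 0)) ((List.range k).map x) (X.init (x k)) := by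
  induction k with
  | zero => rfl
  | succ k ih =>
    rw [List.range_succ, List.map_append]
    exact ih.append X ⟨rfl, h k⟩

theorem IsWalk.getElem {v w : V} {l : List X.Dart} (h : X.IsWalk v l w) :
    (∀ (h : 0 < l.length), X.init l[0] = v) ∧
    (∀ (i : ℕ) (h : i + 1 < l.length), X.term l[i] = X.init l[i + 1]) ∧
    ∀ (h : 0 < l.length), X.term (l[l.length - 1]) = w := by
  induction l generalizing v with
  | nil => simp
  | cons a l ih =>
    obtain ⟨h1, h2, h3⟩ := ih h.2
    refine ⟨fun _ => h.1, fun i hi => ?_, fun _ => ?_⟩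
    · cases i with
      | zero => exact (h1 (by simpa using hi)).symm
      | succ i => exact h2 i (by simpa using hi)
    · cases l with
      | nil => exact h.2
      | cons b l => exact h3 (by simp)

/-- Prime paths are the primitive lists for the relation of following without backtrack. -/
theorem isPrimePath_iff_isPrimitiveList {l : List X.Dart} :
    X.IsPrimePath l ↔ IsPrimitiveList (fun a b => X.term a = X.init b ∧ b ≠ X.inv a) l := by
  constructor
  · rintro ⟨⟨hne, v, hw⟩, hchain, htail, hprim⟩
    obtain ⟨x, hx, hl⟩ := exists_periodic_extension hne
    have hpos := List.length_pos_of_ne_nil hne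
    obtain ⟨h1, h2, h3⟩ := hw.getElem
    have hget (i : ℕ) (hi : i < l.length) : l[i] = x i := by
      have := List.getElem_of_eq hl hi
      simpa using this
    have hlast : x l.length = x 0 := by
      have := isPeriodicPt_seqShift_iff.1 hx 0
      rwa [zero_add] at this
    have hr : ∀ i, X.term (x i) = X.init (x (i + 1)) ∧ x (i + 1) ≠ X.inv (x i) := by
      refine rel_of_isPeriodicPt hpos hx
        (r := fun a b => X.term a = X.init b ∧ b ≠ X.inv a) fun i hi => ?_
      by_cases hi' : i + 1 < l.length
      · rw [← hget i hi, ← hget _ hi']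
        exact ⟨h2 i hi', List.isChain_iff_getElem.1 hchain i hi'⟩
      -- At the last index the next term is the first one, so closedness and the absence of a tail
      -- provide the relation.
      · have hi'' : i = l.length - 1 := by lia
        have hi3 : x (i + 1) = x 0 := by rw [← hlast]; congr 1; lia
        subst hi''
        rw [hi3, ← hget _ hi, ← hget 0 hpos]
        refine ⟨(h3 hpos).trans (h1 hpos).symm, htail _ ?_ _ ?_⟩
        · rw [List.head?_eq_getElem?, List.getElem?_eq_getElem hpos]
          rfl
        · rw [List.getLast?_eq_getElem?, List.getElem?_eq_getElem hi]
          rfl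
    have hdvd := hx.minimalPeriod_dvd
    have hmpos := hx.minimalPeriod_pos hpos
    refine ⟨x, hr, hmpos, ?_⟩
    obtain ⟨k, hk⟩ := hdvd
    -- If the minimal period were a proper divisor of the length, the path would be a proper power
    -- of a closed path.
    have hk1 : k = 1 := by
      by_contra hk1
      have hk0 : k ≠ 0 := by
        rintro rfl
        lia
      set n := Function.minimalPeriod seqShift x with hn
      have hxn : Function.IsPeriodicPt seqShift n x := Function.isPeriodicPt_minimalPeriod _ _
      refine hprim ⟨(List.range n).map x, k, ⟨?_, X.init (x 0), ?_⟩, by lia, ?_⟩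
      · intro h
        have := congrArg List.length h
        simp at this
        lia
      · have h4 := isWalk_map_range (fun i => (hr i).1) n
        have h5 := isPeriodicPt_seqShift_iff.1 hxn 0
        rw [zero_add] at h5
        rwa [h5] at h4
      · rw [flatten_replicate_map_range hxn, mul_comm, ← hk]
        exact hl
    rw [hk1, mul_one] at hk
    rw [← hk]
    exact hl
  · rintro ⟨x, hr, hpos, rfl⟩
    set n := Function.minimalPeriod seqShift x with hn
    have hxn : Function.IsPeriodicPt seqShift n x := Function.isPeriodicPt_minimalPeriod _ _
    have hxn0 := isPeriodicPt_seqShift_iff.1 hxn 0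
    rw [zero_add] at hxn0
    refine ⟨⟨?_, X.init (x 0), ?_⟩, ?_, ?_, ?_⟩
    · intro h
      have := congrArg List.length h
      simp at this
      lia
    · have := isWalk_map_range (fun i => (hr i).1) n
      rwa [hxn0] at this
    · rw [List.isChain_iff_getElem]
      intro i hi
      simpa using (hr i).2
    · intro a ha b hb
      rw [List.head?_eq_getElem?] at ha
      rw [List.getLast?_eq_getElem?] at hb
      obtain ⟨h1, h2⟩ := List.getElem?_eq_some_iff.1 ha
      obtain ⟨h3, h4⟩ := List.getElem?_eq_some_iff.1 hb
      simp only [List.getElem_map, List.getElem_range, List.length_map, List.length_range] at h2 h4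
      rw [← h2, ← h4, ← hxn0]
      have := (hr (n - 1)).2
      rwa [Nat.sub_add_cancel hpos] at this
    · rintro ⟨c, k, ⟨hc, -⟩, hk, hck⟩
      obtain ⟨y, hy, hcy⟩ := exists_periodic_extension hc
      have hcpos := List.length_pos_of_ne_nil hc
      rw [hcy, flatten_replicate_map_range hy] at hck
      have hlen := congrArg List.length hck
      simp only [List.length_map, List.length_range] at hlen
      rw [← hlen] at hck
      -- A proper power would give the sequence a period shorter than its minimal one.
      have hxy : x = y := eq_of_isPeriodicPt hpos hxn (by
        rw [hlen]
        exact hy.const_mul k) hck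
      have := Function.IsPeriodicPt.minimalPeriod_le hcpos (hxy ▸ hy)
      rw [← hn] at this
      nlinarith

theorem Prime.length_pos (p : X.Prime) : 0 < p.length := by
  obtain ⟨l, hl, hp⟩ := p.2
  rw [Prime.length, ← hl, Cycle.length_coe]
  exact List.length_pos_of_ne_nil hp.1.1

theorem finite_setOf_length_le [Finite E] (N : ℕ) : {p : X.Prime | p.length ≤ N}.Finite := by
  refine Set.Finite.of_finite_image (f := Subtype.val) ?_ Subtype.val_injective.injOn
  have h : {l : List X.Dart | l.length ≤ N}.Finite := List.finite_length_le X.Dart N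
  refine (h.image ((↑) : List X.Dart → Cycle X.Dart)).subset ?_
  rintro _ ⟨p, hp, rfl⟩
  obtain ⟨l, hl, -⟩ := p.2
  refine ⟨l, ?_, hl⟩
  have hp : p.length ≤ N := hp
  rwa [Prime.length, ← hl, Cycle.length_coe] at hp

variable [Fintype E] [DecidableEq V] [DecidableEq E]

open PowerSeries in
/-- The weighted Euler product over the primes is the inverse of the reverse characteristic
polynomial of the edge matrix. -/
theorem hasProd_euler (c : X.Dart → ℂ) :
    HasProd (fun p : X.Prime => (1 - C (p.1.weight c) * PowerSeries.X ^ p.length)⁻¹)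
      ((X.edgeMat c).charpolyRev : ℂ⟦X⟧)⁻¹ := by
  rw [HasProd, PowerSeries.WithPiTopology.tendsto_iff_coeff_tendsto]
  intro N
  refine tendsto_const_nhds.congr' ?_
  rw [SummationFilter.unconditional_filter]
  -- The coefficient of degree N is already correct for every finite set containing all primes of
  -- length at most N.
  filter_upwards [Filter.eventually_ge_atTop (finite_setOf_length_le (X := X) N).toFinset] with s hs
  symm
  refine PowerSeries.coeff_eq_of_derivative (N := N) ?_
    (PowerSeries.derivative_prod_eq_mul_sum s _ _ fun p _ =>
      PowerSeries.derivative_inv_one_sub _ p.length_pos)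
    (Matrix.derivative_inv_charpolyRev (X.edgeMat c)) ?_ le_rfl
  · rw [map_prod, constantCoeff_inv, ← coeff_zero_eq_constantCoeff_apply, Polynomial.coeff_coe,
      Polynomial.coeff_zero_eq_eval_zero, Matrix.eval_charpolyRev, inv_one]
    refine Finset.prod_eq_one fun p _ => ?_
    simp [p.length_pos.ne']
  · intro m hm
    have h := trace_pow_eq_sum_cycles (fun a b => X.term a = X.init b ∧ b ≠ X.inv a) c m.succ_pos
      (s.map ⟨fun p : X.Prime => p.1, fun p q h => Subtype.ext h⟩) (by
        intro κ hκ
        obtain ⟨p, -, rfl⟩ := Finset.mem_map.1 hκ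
        obtain ⟨l, hl, hp⟩ := p.2
        exact ⟨l, hl, isPrimePath_iff_isPrimitiveList.1 hp⟩) (by
        intro l hl hlen
        let p : X.Prime := ⟨l, l, rfl, isPrimePath_iff_isPrimitiveList.2 hl⟩
        have hp : p.length ≤ N := (Cycle.length_coe l).le.trans (hlen.trans hm)
        exact Finset.mem_map.2 ⟨p, hs ((Set.Finite.mem_toFinset _).2 hp), rfl⟩)
    rw [coeff_mk, map_sum]
    refine Eq.trans ?_ h.symm
    rw [Finset.sum_map]
    exact Finset.sum_congr rfl fun p _ => by rw [coeff_mk]; rfl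

end EulerProduct

end Multigraph

namespace Multigraph

variable {V E : Type*} (X : Multigraph V E)

/-! ### Laplacians twisted by characters -/

section TwistedLaplacian

variable {X} in
/-- The weights of the oriented edges given by a character and a voltage assignment. -/
def charWeight {G : Type*} [Group G] (γ : X.Dart → G) (χ : G →* ℂˣ) : X.Dart → ℂ := fun b => χ (γ b)

variable [Fintype V] [Fintype E] [DecidableEq V]

/-- The columns of L sum to 0, so L + xJ = (1 + ((x − 1)/|V|)J)(L + J), where the first factor has
determinant x. -/
theorem det_lapMat_one_add [Nonempty V] (x : ℂ) :
    (X.lapMat (1 : X.Dart → ℂ) + Matrix.of fun _ _ => x).det =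
      x * (Fintype.card V ^ 2 * X.kappa) := by
  set L := X.lapMat (1 : X.Dart → ℂ) with hL
  have hn : (Fintype.card V : ℂ) ≠ 0 := by exact_mod_cast Fintype.card_ne_zero
  have h1 : (L + Matrix.of fun _ _ => (1 : ℂ)).det = (Fintype.card V : ℂ) ^ 2 * X.kappa := by
    have h := congrArg (Int.cast (R := ℂ)) X.det_lapMat_add_one
    rw [Int.cast_mul, Int.cast_pow, Int.cast_natCast, Int.cast_natCast] at h
    rw [← h]
    refine Eq.trans ?_ (RingHom.map_det (Int.castRingHom ℂ) _).symm
    congr 1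
    ext v w
    simp only [hL, lapMat, adjMat, degMat, Matrix.add_apply, Matrix.sub_apply, Matrix.of_apply,
      Matrix.diagonal_apply, RingHom.mapMatrix_apply, Matrix.map_apply, Pi.one_apply]
    split_ifs <;> simp
  have h2 : L + Matrix.of (fun _ _ => x) =
      (1 + Matrix.replicateCol Unit (fun _ : V => (x - 1) / Fintype.card V) *
        Matrix.replicateRow Unit fun _ : V => (1 : ℂ)) * (L + Matrix.of fun _ _ => (1 : ℂ)) := by
    rw [add_mul, one_mul]
    ext v w
    have h3 : ∑ j, (x - 1) / Fintype.card V * (L j w + 1) = x - 1 := by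
      rw [← Finset.mul_sum, Finset.sum_add_distrib, hL, X.sum_lapMat_one]
      simp [field]
    simp only [Matrix.add_apply, Matrix.of_apply, Matrix.mul_apply,
      Matrix.replicateCol_apply, Matrix.replicateRow_apply, Finset.univ_unique,
      Finset.sum_singleton, mul_one]
    rw [h3]
    ring
  rw [h2, Matrix.det_mul, h1, Matrix.det_one_add_replicateCol_mul_replicateRow]
  simp only [dotProduct, one_mul, Finset.sum_const, Finset.card_univ, nsmul_eq_mul]
  field_simp
  ring

theorem det_lapMat_one [Nonempty V] : (X.lapMat (1 : X.Dart → ℂ)).det = 0 := by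
  have h := X.det_lapMat_one_add 0
  rw [zero_mul] at h
  rw [← h]
  congr 1
  ext v w
  simp

variable {X} in
/-- The determinant of the Laplacian of the cover given by a voltage assignment, made invertible
by adding the matrix all of whose entries are one. -/
theorem det_lapMat_voltage [Nonempty V] {G : Type*} [CommGroup G] [Fintype G] [DecidableEq G]
    [Fintype (G →* ℂˣ)] (γ : X.Dart → G) :
    (Matrix.of fun p q : V × G => (if p = q then (X.degree p.1 : ℂ) else 0) -
      (∑ b, if X.init b = p.1 ∧ X.term b = q.1 ∧ p.2 * γ b = q.2 then 1 else 0) + 1).det =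
      Fintype.card G * (Fintype.card V ^ 2 * X.kappa) *
        ∏ χ ∈ Finset.univ.erase (1 : G →* ℂˣ), (X.lapMat (charWeight γ χ)).det := by
  have h := Matrix.det_blockCirculant (V := V) (G := G) fun v w k =>
    (if v = w ∧ k = 1 then (X.degree v : ℂ) else 0) -
      (∑ b, if X.init b = v ∧ X.term b = w ∧ γ b = k then 1 else 0) + 1
  -- Fourier transform of the blocks: the all-ones part becomes ∑ χ(g), which is |G| for χ = 1 and
  -- vanishes otherwise.
  have hK (χ : G →* ℂˣ) : (Matrix.of fun v w => ∑ g, (χ g : ℂ) *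
      ((if v = w ∧ g = 1 then (X.degree v : ℂ) else 0) -
      (∑ b, if X.init b = v ∧ X.term b = w ∧ γ b = g then 1 else 0) + 1)) =
      X.lapMat (charWeight γ χ) + Matrix.of fun _ _ => ∑ g, (χ g : ℂ) := by
    ext v w
    simp only [Matrix.of_apply, Matrix.add_apply, mul_add, mul_sub, mul_one,
      Finset.sum_add_distrib, Finset.sum_sub_distrib, lapMat, Matrix.sub_apply, degMat, adjMat,
      Matrix.diagonal_apply, Finset.mul_sum]
    congr 2
    · rw [Finset.sum_eq_single 1] <;> simp +contextual
    · rw [Finset.sum_comm]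
      refine Finset.sum_congr rfl fun b _ => ?_
      rw [Finset.sum_eq_single (γ b)]
      · simp [charWeight]
      · intro g _ hg
        simp [hg.symm]
      · simp
  simp only [hK] at h
  rw [← Finset.mul_prod_erase _ _ (Finset.mem_univ 1)] at h
  have h1 : X.lapMat (charWeight γ 1) = X.lapMat (1 : X.Dart → ℂ) := by
    congr 1
  have h2 : ∑ g : G, (((1 : G →* ℂˣ) g : ℂˣ) : ℂ) = Fintype.card G := by simp
  rw [h1, h2, det_lapMat_one_add] at h
  refine Eq.trans ?_ (h.trans ?_)
  · congr 1
    ext p q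
    simp only [Matrix.of_apply, inv_mul_eq_one, Prod.ext_iff, eq_inv_mul_iff_mul_eq]
  · congr 1
    refine Finset.prod_congr rfl fun χ hχ => ?_
    rw [sum_char_eq_zero (Finset.ne_of_mem_erase hχ)]
    congr 1
    ext v w
    simp

end TwistedLaplacian

namespace Cover

variable {W F : Type*} {Y : Multigraph W F} {X : Multigraph V E} (π : Cover Y X)

/-! ### Voltage assignments of Galois covers -/

section Voltage

/-- `s` is a section of the cover on the vertices, and `γ` is the voltage assignment that it
determines. -/
structure IsVoltage (s : V → W) (γ : X.Dart → π.Deck) : Prop where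
  vert_section : ∀ v, π.vert (s v) = v
  exists_dart : ∀ b, ∃ a, Y.init a = s (X.init b) ∧ π.dart a = b ∧
    Y.term a = (γ b).1.1 (s (X.term b))

variable {π}

theorem exists_isVoltage (hGal : π.IsGalois) (hsurj : Function.Surjective π.vert) :
    ∃ s γ, π.IsVoltage s γ := by
  obtain ⟨s, hs⟩ := hsurj.hasRightInverse
  have h (b : X.Dart) : ∃ (g : π.Deck) (a : Y.Dart), Y.init a = s (X.init b) ∧ π.dart a = b ∧
      Y.term a = g.1.1 (s (X.term b)) := by
    obtain ⟨a, ha, hab⟩ := π.exists_lift_dart (hs (X.init b)).symm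
    obtain ⟨g, hg⟩ := hGal (s (X.term b)) (Y.term a) (by rw [hs, ← π.term_dart, hab])
    exact ⟨g, a, ha, hab, hg.symm⟩
  choose γ hγ using h
  exact ⟨s, γ, hs, hγ⟩

namespace IsVoltage

variable {s : V → W} {γ : X.Dart → π.Deck} (h : π.IsVoltage s γ)

include h

theorem exists_lift (g : π.Deck) (b : X.Dart) : ∃ a, Y.init a = g.1.1 (s (X.init b)) ∧
    π.dart a = b ∧ Y.term a = (g * γ b).1.1 (s (X.term b)) := by
  obtain ⟨a, h1, h2, h3⟩ := h.exists_dart b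
  exact ⟨g.1.2 a, by rw [deck_init, h1], by rw [dart_deck, h2],
    by rw [deck_term, h3, deck_mul_apply]⟩

theorem term_eq {g : π.Deck} {a : Y.Dart} (ha : Y.init a = g.1.1 (s (X.init (π.dart a)))) :
    Y.term a = (g * γ (π.dart a)).1.1 (s (X.term (π.dart a))) := by
  obtain ⟨a', h1, h2, h3⟩ := h.exists_lift g (π.dart a)
  rw [← h3, π.eq_of_init_eq_of_dart_eq (ha.trans h1.symm) h2.symm]

/-- Reversing the lift of b gives a lift of its inverse. This supplies the condition on weights in
Bass's formula. -/
theorem mul_inv (hY : Y.Connected) (b : X.Dart) : γ b * γ (X.inv b) = 1 := by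
  obtain ⟨a, h1, h2, h3⟩ := h.exists_dart b
  have h4 := h.term_eq (g := γ b) (a := Y.inv a) (by
    rw [init_inv, π.dart_inv, h2, init_inv, h3])
  rw [term_inv, π.dart_inv, h2, term_inv, h1] at h4
  exact deck_eq_one_of_apply_eq hY h4.symm

/-- In the coordinates W ≅ V × G, walking along a lift multiplies the group coordinate on the right
by the voltages. -/
theorem isWalk_apply {w w' : W} {l : List Y.Dart} (hl : Y.IsWalk w l w') {g : π.Deck}
    (hw : w = g.1.1 (s (π.vert w))) :
    w' = (g * (l.map fun a => γ (π.dart a)).prod).1.1 (s (π.vert w')) := by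
  induction l generalizing w g with
  | nil =>
    obtain rfl : w = w' := hl
    simpa using hw
  | cons a l ih =>
    obtain ⟨rfl, hl⟩ := hl
    rw [List.map_cons, List.prod_cons, ← mul_assoc]
    refine ih hl ?_
    rw [← π.term_dart]
    exact h.term_eq (by rw [π.init_dart]; exact hw)

theorem exists_isWalk {v v' : V} {l : List X.Dart} (hl : X.IsWalk v l v') (g : π.Deck) :
    ∃ l' : List Y.Dart, l'.map π.dart = l ∧
      Y.IsWalk (g.1.1 (s v)) l' ((g * (l.map γ).prod).1.1 (s v')) := by
  induction l generalizing v g with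
  | nil =>
    obtain rfl : v = v' := hl
    exact ⟨[], rfl, by simp [IsWalk]⟩
  | cons b l ih =>
    obtain ⟨rfl, hl⟩ := hl
    obtain ⟨a, h1, h2, h3⟩ := h.exists_lift g b
    obtain ⟨l', h4, h5⟩ := ih hl (g * γ b)
    refine ⟨a :: l', by rw [List.map_cons, h2, h4], h1, ?_⟩
    rw [List.map_cons, List.prod_cons, ← mul_assoc, h3]
    exact h5

/-- The value of a character at a Frobenius automorphism is the weight of the prime. -/
theorem char_eq_weight (hY : Y.Connected) (hGal : π.IsGalois) (χ : π.Deck →* ℂˣ) {p : X.Prime}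
    {g : π.Deck} (hg : π.IsFrobenius p g) : (χ g : ℂ) = p.1.weight (charWeight γ χ) := by
  obtain ⟨w, w', l, hl, hp, rfl⟩ := hg
  obtain ⟨k, hk⟩ := hGal (s (π.vert w)) w (h.vert_section _)
  have h1 := h.isWalk_apply hl hk.symm
  rw [π.vert_deck, ← hk, π.vert_deck, h.vert_section, ← deck_mul_apply] at h1
  have h2 := congrArg χ (deck_apply_injective hY _ h1)
  -- The position k of the starting vertex cancels since χ has commutative values, so neither the
  -- lift nor the choice of Frobenius matters.
  rw [map_mul, map_mul, mul_comm] at h2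
  rw [← hp, weight_coe, List.map_map, mul_left_cancel h2, map_list_prod, List.map_map]
  exact (map_list_prod (Units.coeHom ℂ) _).trans (by rw [List.map_map]; rfl)

theorem exists_isFrobenius (p : X.Prime) : ∃ g, π.IsFrobenius p g := by
  obtain ⟨l, hl, ⟨-, v, hv⟩, -⟩ := p.2
  obtain ⟨l', h1, h2⟩ := h.exists_isWalk hv 1
  refine ⟨(l.map γ).prod, s v, _, l', h2, by rw [h1, hl], ?_⟩
  rw [one_mul]

variable [Fintype E] [DecidableEq V] [DecidableEq E]

open PowerSeries in
theorem hasProd_eulerFactor (hY : Y.Connected) (hGal : π.IsGalois) (χ : π.Deck →* ℂˣ) :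
    HasProd (π.eulerFactor χ) ((X.edgeMat (charWeight γ χ)).charpolyRev : ℂ⟦X⟧)⁻¹ := by
  have hp : π.eulerFactor χ =
      fun p : X.Prime => (1 - C (p.1.weight (charWeight γ χ)) * PowerSeries.X ^ p.length)⁻¹ := by
    ext1 p
    rw [eulerFactor, frob,
      h.char_eq_weight hY hGal χ (Classical.epsilon_spec (h.exists_isFrobenius p))]
  rw [hp]
  exact hasProd_euler (charWeight γ χ)

/-- The constant coefficient 1 permits inverting twice. Uniqueness of P makes the choice inside
`LStar` harmless. -/
theorem isLInverse_iff (hY : Y.Connected) (hGal : π.IsGalois) (χ : π.Deck →* ℂˣ)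
    (P : Polynomial ℂ) : π.IsLInverse χ P ↔ P = (X.edgeMat (charWeight γ χ)).charpolyRev := by
  set Q := (X.edgeMat (charWeight γ χ)).charpolyRev with hQ
  have h1 : PowerSeries.constantCoeff (Q : PowerSeries ℂ) = 1 := by
    rw [hQ, ← PowerSeries.coeff_zero_eq_constantCoeff_apply, Polynomial.coeff_coe,
      Polynomial.coeff_zero_eq_eval_zero, Matrix.eval_charpolyRev]
  have h2 : ((Q : PowerSeries ℂ)⁻¹)⁻¹ = Q := by
    rw [PowerSeries.inv_eq_iff_mul_eq_one (by simp [h1])]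
    exact PowerSeries.mul_inv_cancel _ (by simp [h1])
  rw [IsLInverse, artinL, (h.hasProd_eulerFactor hY hGal χ).tprod_eq, h2, Polynomial.coe_inj]

theorem LStar_eq (hY : Y.Connected) (hGal : π.IsGalois) (χ : π.Deck →* ℂˣ) :
    π.LStar χ =
      (Polynomial.taylor 1 (X.edgeMat (charWeight γ χ)).charpolyRev).trailingCoeff := by
  have hex : ∃ P : Polynomial ℂ, π.IsLInverse χ P := ⟨_, (h.isLInverse_iff hY hGal χ _).2 rfl⟩
  rw [LStar, dif_pos hex, (h.isLInverse_iff hY hGal χ _).1 hex.choose_spec]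

end IsVoltage

end Voltage

end Cover

end Multigraph

namespace Multigraph

variable {V E W F : Type*} {X : Multigraph V E} {Y : Multigraph W F}

/-! ### The number of edges -/

section EdgeCount

variable [Fintype V] [Fintype E]

/-- If |E| < |V|, the degree sum 2|E| forces a vertex of degree less than 2. With degree one
excluded it is isolated, hence the only vertex, and there are no edges. -/
theorem card_le_card_edges_or (hX : X.Connected) (hX1 : ∀ v, X.degree v ≠ 1) :
    Fintype.card V ≤ Fintype.card E ∨ IsEmpty E := by
  classical
  by_contra! hcon
  obtain ⟨hlt, ⟨e⟩⟩ := hcon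
  have h1 : ∑ v, X.degree v = 2 * Fintype.card E := by
    simp only [degree, Nat.card_eq_fintype_card]
    rw [← Fintype.card_sigma, Fintype.card_congr (Equiv.sigmaFiberEquiv X.init), Fintype.card_prod,
      Fintype.card_bool, mul_comm]
  obtain ⟨v, hv⟩ : ∃ v, X.degree v < 2 := by
    by_contra! h
    have := Finset.sum_le_sum fun v (_ : v ∈ Finset.univ) => h v
    rw [h1, Finset.sum_const, Finset.card_univ, smul_eq_mul] at this
    lia
  have hv0 : X.degree v = 0 := by
    have := hX1 v
    lia
  have hempty : IsEmpty {a : X.Dart // X.init a = v} := by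
    rwa [degree, Nat.card_eq_fintype_card, Fintype.card_eq_zero_iff] at hv0
  have hall : ∀ u, u = v := hX.induction (P := fun u => u = v)
    (fun a _ ha => (hempty.false ⟨a, ha⟩).elim) rfl
  exact hempty.false ⟨(e, true), hall _⟩

end EdgeCount

/-! ### The equivariant determinant -/

section GroupRing

variable [Fintype V] [Fintype E] [DecidableEq V] {G : Type*} [CommGroup G]

/-- The determinant of the Laplacian with coefficients in the group ring. -/
theorem exists_charEval_eq_det [Nonempty V] (γ : X.Dart → G) :
    ∃ η : MonoidAlgebra ℤ G, augmentation G η = 0 ∧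
      ∀ χ : G →* ℂˣ, charEval ℤ χ η = (X.lapMat (charWeight γ χ⁻¹)).det := by
  -- The inverse voltages match the conjugate idempotents in θ*, whose value at χ is L*(1, χ⁻¹).
  let M : Matrix V V (MonoidAlgebra ℤ G) := X.lapMat fun b => MonoidAlgebra.single (γ b)⁻¹ 1
  have h (χ : G →* ℂˣ) : charEval ℤ χ M.det = (X.lapMat (charWeight γ χ⁻¹)).det := by
    rw [AlgHom.map_det]
    congr 1
    ext v w
    simp only [M, AlgHom.mapMatrix_apply, Matrix.map_apply, lapMat, Matrix.sub_apply, map_sub,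
      degMat, adjMat, Matrix.diagonal_apply, map_sum, apply_ite (charEval ℤ χ), map_zero,
      map_natCast, charEval_single, charWeight, map_inv, MonoidHom.inv_apply]
    simp
  refine ⟨M.det, ?_, h⟩
  -- The trivial character gives the ordinary Laplacian, which is singular; hence the augmentation
  -- vanishes.
  have h1 := h 1
  have h2 : X.lapMat (charWeight γ (1 : G →* ℂˣ)⁻¹) = X.lapMat (1 : X.Dart → ℂ) := by
    congr 1
  rw [charEval_one_eq, h2, det_lapMat_one] at h1
  exact_mod_cast h1

end GroupRing

namespace Cover

/-! ### The Laplacian of the cover in voltage coordinates -/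

section Determinant

variable [Fintype V] [Fintype E] [Fintype W] [Fintype F] {π : Cover Y X}

omit [Fintype V] [Fintype W] in
theorem degree_vert (w : W) : X.degree (π.vert w) = Y.degree w := by
  classical
  have := π.sum_star (fun _ => (1 : ℤ)) w
  rw [← degree_eq_sum, ← degree_eq_sum] at this
  exact_mod_cast this.symm

namespace IsVoltage

variable {s : V → W} {γ : X.Dart → π.Deck} (h : π.IsVoltage s γ)

include h

omit [Fintype V] [Fintype E] [Fintype W] [Fintype F] in
theorem bijective_apply (hY : Y.Connected) (hGal : π.IsGalois) :
    Function.Bijective fun p : V × π.Deck => p.2.1.1 (s p.1) := by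
  constructor
  · rintro ⟨v, g⟩ ⟨v', g'⟩ hgg
    have hgg : g.1.1 (s v) = g'.1.1 (s v') := hgg
    have hv := congrArg π.vert hgg
    rw [π.vert_deck, π.vert_deck, h.vert_section, h.vert_section] at hv
    subst hv
    rw [deck_apply_injective hY (s v) hgg]
  · intro w
    obtain ⟨g, hg⟩ := hGal (s (π.vert w)) w (h.vert_section _)
    exact ⟨(π.vert w, g), hg⟩

omit [Fintype V] [Fintype W] in
-- In voltage coordinates Y is the derived graph: the lift of b starting at (v, g) ends at group
-- coordinate gγ(b).
theorem lapMat_apply [DecidableEq V] [DecidableEq W] [DecidableEq π.Deck]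
    (hY : Y.Connected) (hGal : π.IsGalois) (p q : V × π.Deck) :
    Y.lapMat (1 : Y.Dart → ℂ) (p.2.1.1 (s p.1)) (q.2.1.1 (s q.1)) =
      (if p = q then (X.degree p.1 : ℂ) else 0) -
        ∑ b, if X.init b = p.1 ∧ X.term b = q.1 ∧ p.2 * γ b = q.2 then 1 else 0 := by
  have hp : π.vert (p.2.1.1 (s p.1)) = p.1 := by rw [π.vert_deck, h.vert_section]
  have hinj (p q : V × π.Deck) : p.2.1.1 (s p.1) = q.2.1.1 (s q.1) ↔ p = q :=
    (h.bijective_apply hY hGal).1.eq_iff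
  rw [lapMat, Matrix.sub_apply, degMat, Matrix.diagonal_apply, adjMat]
  congr 1
  · simp only [hinj, ← π.degree_vert, hp]
  · have h1 := π.sum_star
      (fun b => if X.term b = q.1 ∧ p.2 * γ b = q.2 then (1 : ℂ) else 0) (p.2.1.1 (s p.1))
    rw [hp] at h1
    simp only [ite_and]
    simp only [ite_and] at h1
    rw [← h1]
    refine Finset.sum_congr rfl fun a _ => ?_
    by_cases ha : Y.init a = p.2.1.1 (s p.1)
    · have h2 := h.term_eq (g := p.2) (a := a) (by rw [π.init_dart, ha, hp])
      have h3 := hinj (X.term (π.dart a), p.2 * γ (π.dart a)) q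
      rw [Prod.ext_iff] at h3
      rw [if_pos ha, if_pos ha, h2]
      simp only [h3, ite_and, Pi.one_apply]
    · rw [if_neg ha, if_neg ha]

/-- Two evaluations of det(L_Y + J): |W|²κ_Y by the matrix-tree theorem, and the product over
characters. With |W| = |V||G|, the factor |G||V|² cancels. -/
theorem prod_det_lapMat [DecidableEq V] (hX : X.Connected)
    (hY : Y.Connected) (hGal : π.IsGalois) (hab : ∀ g h : π.Deck, g * h = h * g) :
    X.kappa * ∏ χ ∈ Finset.univ.erase (1 : π.Deck →* ℂˣ), (X.lapMat (charWeight γ χ)).det =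
      Fintype.card π.Deck * Y.kappa := by
  let _ := Classical.decEq π.Deck
  let _ := Classical.decEq W
  let _ : CommGroup π.Deck := { (inferInstance : Group π.Deck) with mul_comm := hab }
  have := hX.1
  have := hY.1
  let e : V × π.Deck ≃ W := Equiv.ofBijective _ (h.bijective_apply hY hGal)
  have h1 : ((Y.lapMat (1 : Y.Dart → ℂ) + Matrix.of fun _ _ => 1).submatrix e e).det = _ :=
    (Matrix.det_submatrix_equiv_self e _).trans (Y.det_lapMat_one_add 1)
  have h2 : (Y.lapMat (1 : Y.Dart → ℂ) + Matrix.of fun _ _ => 1).submatrix e e =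
      Matrix.of fun p q : V × π.Deck => (if p = q then (X.degree p.1 : ℂ) else 0) -
        (∑ b, if X.init b = p.1 ∧ X.term b = q.1 ∧ p.2 * γ b = q.2 then 1 else 0) + 1 := by
    ext p q
    exact congrArg (· + 1) (h.lapMat_apply hY hGal p q)
  rw [h2, one_mul, ← Fintype.card_congr e, Fintype.card_prod] at h1
  have h3 := (det_lapMat_voltage γ).symm.trans h1
  have hV : (Fintype.card V : ℂ) ≠ 0 := by exact_mod_cast Fintype.card_ne_zero
  have hG : (Fintype.card π.Deck : ℂ) ≠ 0 := by exact_mod_cast Fintype.card_ne_zero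
  refine mul_left_cancel₀ (mul_ne_zero hG (pow_ne_zero 2 hV)) ?_
  push_cast at h3
  linear_combination h3

end IsVoltage

end Determinant

end Cover

end Multigraph

namespace Multigraph

namespace Cover

variable {V E W F : Type*} {X : Multigraph V E} {Y : Multigraph W F}

/-! ### Character values of the equivariant special value -/

section SpecialValue

variable {π : Cover Y X}

theorem sum_char_mul_char_inv [Finite W] [Finite F] (hab : ∀ g h : π.Deck, g * h = h * g) [DecidableEq (π.Deck →* ℂˣ)]
    (χ ψ : π.Deck →* ℂˣ) :
    ∑ g, (χ g : ℂ) * (ψ g⁻¹ : ℂ) = if ψ = χ then (Fintype.card π.Deck : ℂ) else 0 := by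
  let _ : CommGroup π.Deck := { (inferInstance : Group π.Deck) with mul_comm := hab }
  refine Eq.trans (Finset.sum_congr rfl fun g _ => ?_) ((sum_char_inv_mul ψ χ).trans ?_)
  · rw [map_inv, Units.val_inv_eq_inv_val, mul_comm]
  · congr

theorem isEmpty_edges (π : Cover Y X) [IsEmpty E] : IsEmpty F :=
  ⟨fun f => isEmptyElim (π.dart (f, true)).1⟩

/-- Without edges a connected Y is a single vertex, and an automorphism is determined by the image
of a vertex. -/
theorem subsingleton_deck (hY : Y.Connected) [IsEmpty E] : Subsingleton π.Deck := by
  have := π.isEmpty_edges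
  obtain ⟨w⟩ := hY.1
  have hall : ∀ u, u = w := hY.induction (P := fun u => u = w)
    (fun a _ _ => isEmptyElim a.1) rfl
  exact ⟨fun g h => deck_apply_injective hY w ((hall _).trans (hall _).symm)⟩

/-- The value of a character at `θ* e`. -/
theorem lift_thetaStarE [Finite W] [Finite F] (hab : ∀ g h : π.Deck, g * h = h * g) [DecidableEq (π.Deck →* ℂˣ)]
    (ψ : π.Deck →* ℂˣ) :
    MonoidAlgebra.lift ℂ ℂ π.Deck ((Units.coeHom ℂ).comp ψ) π.thetaStarE =
      if ψ = 1 then 0 else π.LStar ψ⁻¹ := by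
  have hn : (Fintype.card π.Deck : ℂ) ≠ 0 := by exact_mod_cast Fintype.card_ne_zero
  have hidem (χ : π.Deck →* ℂˣ) :
      MonoidAlgebra.lift ℂ ℂ π.Deck ((Units.coeHom ℂ).comp ψ) (π.idem χ) =
        if ψ = χ then 1 else 0 := by
    have h1 : MonoidAlgebra.lift ℂ ℂ π.Deck ((Units.coeHom ℂ).comp ψ) (π.idem χ) =
        1 / (Nat.card π.Deck : ℂ) * ∑ g, (χ g : ℂ) * (ψ g⁻¹ : ℂ) := by
      rw [idem, map_smul, map_sum, smul_eq_mul]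
      congr 1
      exact Finset.sum_congr rfl fun g _ => MonoidAlgebra.lift_single _ _ _
    rw [h1, sum_char_mul_char_inv hab, Nat.card_eq_fintype_card]
    split_ifs
    · rw [one_div_mul_cancel hn]
    · rw [mul_zero]
  rw [thetaStarE, map_mul, map_sub, map_one, hidem, thetaStar, map_sum]
  simp only [map_smul, hidem, smul_eq_mul, mul_ite, mul_one, mul_zero]
  rw [Finset.sum_eq_single ψ⁻¹]
  · rw [if_pos (_root_.inv_inv ψ).symm]
    split_ifs <;> simp
  · intro χ _ hχ
    refine if_neg fun h => hχ ?_
    rw [h]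
    exact MonoidHom.ext fun g => (_root_.inv_inv (χ g)).symm
  · simp

end SpecialValue

end Cover

end Multigraph

/-! ### The main theorem -/

theorem mainTheorem4 {V E W F : Type*} [Fintype V] [Fintype E] [Fintype W] [Fintype F]
    (X : Multigraph V E) (Y : Multigraph W F) (hX : X.Connected) (hY : Y.Connected)
    (hX1 : ∀ v, X.degree v ≠ 1)
    (π : Multigraph.Cover Y X) (hGal : π.IsGalois) (hab : ∀ g h : π.Deck, g * h = h * g)
    (d : ℕ) (hd : ∀ v, Nat.card {w : W // π.vert w = v} = d) :
    (Nat.card π.JacZero : ℚ) = (Y.kappa : ℚ) / (X.kappa : ℚ) ∧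
    (∀ χ : π.Deck →* ℂˣ, Multipliable (π.eulerFactor χ) ∧
      ∃ P : Polynomial ℂ, π.IsLInverse χ P) ∧
    ∃ t : MonoidAlgebra ℤ π.Deck,
      MonoidAlgebra.mapRingHom π.Deck (Int.castRingHom ℂ) t = π.thetaStarE ∧
      t ∈ π.augIdeal ∧
      (Nat.card (π.augIdeal ⧸ (Ideal.span {t}).submoduleOf π.augIdeal) : ℚ) =
        (2 : ℚ) ^ (((d : ℤ) - 1) * (X.betti - 1)) * (Nat.card π.JacZero : ℚ) := by
  classical
  have hκ := Multigraph.Cover.natCard_jacZero_mul_kappa hX hY hGal hd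
  have hκX : (X.kappa : ℚ) ≠ 0 := by exact_mod_cast (X.kappa_pos hX).ne'
  obtain ⟨s, γ, h⟩ := Multigraph.Cover.exists_isVoltage hGal (Multigraph.Cover.surjective_vert hY hd)
  refine ⟨?_, fun χ => ⟨(h.hasProd_eulerFactor hY hGal χ).multipliable, _,
    (h.isLInverse_iff hY hGal χ _).2 rfl⟩, ?_⟩
  · rw [eq_div_iff hκX]
    exact_mod_cast hκ
  have hkey := h.prod_det_lapMat hX hY hGal hab
  have hcard : Fintype.card π.Deck = d := by
    rw [← Nat.card_eq_fintype_card, Multigraph.Cover.natCard_deck hY hGal hd]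
  let _ : CommGroup π.Deck := { (inferInstance : Group π.Deck) with mul_comm := hab }
  have := hX.1
  have hd0 : (d : ℂ) ≠ 0 := by
    rw [← hcard]
    exact_mod_cast Fintype.card_ne_zero
  have hκX' : (X.kappa : ℂ) ≠ 0 := by exact_mod_cast (X.kappa_pos hX).ne'
  have hκY' : (Y.kappa : ℂ) ≠ 0 := by exact_mod_cast (Y.kappa_pos hY).ne'
  rw [hcard] at hkey
  have hprod : ∏ χ ∈ Finset.univ.erase (1 : π.Deck →* ℂˣ),
      (X.lapMat (Multigraph.charWeight γ χ)).det = d * Nat.card π.JacZero := by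
    refine mul_left_cancel₀ hκX' ?_
    rw [hkey, ← hκ]
    push_cast
    ring
  -- Nonvanishing is read off the product formula, since d and κ_Y are nonzero.
  have hdet (χ : π.Deck →* ℂˣ) (hχ : χ ≠ 1) : (X.lapMat (Multigraph.charWeight γ χ)).det ≠ 0 := by
    have h0 : (X.kappa : ℂ) * ∏ χ ∈ Finset.univ.erase (1 : π.Deck →* ℂˣ),
      (X.lapMat (Multigraph.charWeight γ χ)).det ≠ 0 := hkey ▸ mul_ne_zero hd0 hκY'
    exact Finset.prod_ne_zero_iff.1 (right_ne_zero_of_mul h0) χ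
      (Finset.mem_erase.2 ⟨hχ, Finset.mem_univ _⟩)
  have hne {χ : π.Deck →* ℂˣ} (hχ : χ ≠ 1) : χ⁻¹ ≠ 1 := fun h =>
    hχ (MonoidHom.ext fun g => inv_eq_one.1 (DFunLike.congr_fun h g))
  obtain ⟨η, hη1, hη⟩ := X.exists_charEval_eq_det γ
  -- Natural subtraction: it truncates only when X has no edges. Then G is trivial and the power of
  -- −2 plays no role.
  set m := Fintype.card E - Fintype.card V with hm
  have hVE : Fintype.card V ≤ Fintype.card E ∨ Subsingleton π.Deck := by
    rcases X.card_le_card_edges_or hX hX1 with h | h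
    · exact Or.inl h
    · exact Or.inr (Multigraph.Cover.subsingleton_deck hY)
  set t : MonoidAlgebra ℤ π.Deck := ((-2 : ℤ) ^ m) • η with ht
  have ht1 : augmentation π.Deck t = 0 := by rw [ht, map_smul, hη1, smul_zero]
  have htχ (χ : π.Deck →* ℂˣ) : charEval ℤ χ t =
      (-2) ^ m * (X.lapMat (Multigraph.charWeight γ χ⁻¹)).det := by
    rw [ht, map_smul, hη, zsmul_eq_mul]
    push_cast
    rfl
  refine ⟨t, charEval_injective fun χ => ?_, ht1, ?_⟩
  · refine (charEval_mapRingHom χ t).trans (Eq.trans ?_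
      (Multigraph.Cover.lift_thetaStarE hab χ).symm)
    split_ifs with hχ
    · rw [hχ, charEval_one_eq, ht1, Int.cast_zero]
    · have hχ' : χ⁻¹ ≠ 1 := hne hχ
      have hVE' : Fintype.card V ≤ Fintype.card E := hVE.resolve_right fun _ =>
        hχ (MonoidHom.ext fun g => by rw [Subsingleton.elim g 1, map_one, map_one])
      have h1 := X.trailingCoeff_taylor_charpolyRev_edgeMat
        (c := Multigraph.charWeight γ χ⁻¹) (fun b => by
          have := congrArg (fun g => (χ⁻¹ : π.Deck →* ℂˣ) g) (h.mul_inv hY b)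
          simp only [map_mul, map_one] at this
          exact congrArg Units.val this) (hdet _ hχ')
      rw [htχ, h.LStar_eq hY hGal]
      refine mul_left_cancel₀ (pow_ne_zero (Fintype.card V) (by norm_num : (-2 : ℂ) ≠ 0)) ?_
      rw [h1, ← mul_assoc, ← pow_add, hm, Nat.add_sub_cancel' hVE']
  -- Each of the d − 1 nontrivial characters contributes 2^m, and the determinants contribute d ·
  -- |Jac⁰(Y)|; this d cancels the factor |G|.
  · have hN := relIndex_span_mul_card t ht1 fun χ hχ => by
      rw [htχ]
      exact mul_ne_zero (pow_ne_zero _ (by norm_num)) (hdet _ (hne hχ))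
    have hchar : Fintype.card (π.Deck →* ℂˣ) = d := by
      rw [← hcard]
      exact (Fintype.card_congr (nonempty_equiv_monoidHom_units π.Deck).some).symm
    have hinv : ∏ χ ∈ Finset.univ.erase (1 : π.Deck →* ℂˣ),
        (X.lapMat (Multigraph.charWeight γ χ⁻¹)).det = d * Nat.card π.JacZero := by
      rw [← hprod]
      exact Finset.prod_equiv (Equiv.inv _) (by simp) fun _ _ => rfl
    have hcardN : Nat.card (π.augIdeal ⧸ (Ideal.span {t}).submoduleOf π.augIdeal) =
        (Ideal.span {t}).toAddSubgroup.relIndex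
          (RingHom.ker (augmentation π.Deck)).toAddSubgroup := rfl
    rw [← hcardN, Finset.prod_congr rfl fun χ _ => htχ χ, Finset.prod_mul_distrib, hinv,
      Finset.prod_const, Finset.card_erase_of_mem (Finset.mem_univ _), Finset.card_univ, hchar,
      hcard] at hN
    simp only [norm_mul, norm_pow, norm_neg, Complex.norm_natCast, Complex.norm_ofNat] at hN
    have hdR : (d : ℝ) ≠ 0 := by exact_mod_cast hd0
    have hN' : (Nat.card (π.augIdeal ⧸ (Ideal.span {t}).submoduleOf π.augIdeal) : ℝ) =
        (2 ^ m) ^ (d - 1) * Nat.card π.JacZero := by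
      refine mul_right_cancel₀ hdR (hN.trans ?_)
      ring
    -- r_X − 1 = |E| − |V|, possibly negative as an integer only when d = 1, where both exponents
    -- are 0.
    have hexp : ((d : ℤ) - 1) * (X.betti - 1) = ((m * (d - 1) : ℕ) : ℤ) := by
      have hd1 : 1 ≤ d := Nat.one_le_iff_ne_zero.2 (by exact_mod_cast hd0)
      rw [Multigraph.betti, Nat.card_eq_fintype_card, Nat.card_eq_fintype_card]
      rcases hVE with hVE | _
      · rw [hm]
        push_cast [Nat.cast_sub hVE, Nat.cast_sub hd1]
        ring
      · have : d = 1 := by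
          rw [← hcard]
          exact Fintype.card_eq_one_iff.2 ⟨1, fun _ => Subsingleton.elim _ _⟩
        simp [this]
    rw [hexp, zpow_natCast, pow_mul]
    exact_mod_cast hN'
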